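/- Let $d\ge 1$ be an integer and $\lambda>0$ a real number. Let $$W(\mathbb R^d)=\{v\in H^1(\mathbb R^d;\mathbb C):\ |v|^2\ln|v|^2\in L^1(\mathbb R^d)\}$$ be the energy space, with the norm $\|v\|_{W}=\|v\|_{H^1}+\inf\{k>0:\int_{\mathbb R^d}A(|v|/k)\,dx\le 1\}$, where $A(s)=-s^2\ln s^2$ for $0\le s\le e^{-3}$ (with $A(0)=0$) and $A(s)=3s^2+4e^{-3}s-e^{-6}$ for $s\ge e^{-3}$. A *solution in the energy space* of the logarithmic Schrödinger equation $$i\,\partial_t u+\tfrac12\Delta u+\lambda\,u\ln|u|^2=0\qquad\text{on }\mathbb R\times\mathbb R^d$$ (with $u\ln|u|^2=0$ where $u=0$) is a function $u\in C(\mathbb R,W(\mathbb R^d))$ that satisfies the equation, at every time $t\in\mathbb R$, in the sense of distributions on $\mathbb R^d$: for every $\varphi\in C_c^\infty(\mathbb R^d;\mathbb C)$ and every $t\in\mathbb R$, $$\frac{d}{dt}\int u(t)\,\varphi\,dx=i\Big(\frac12\int u(t)\,\Delta\varphi\,dx+\lambda\int u(t)\ln|u(t)|^2\,\varphi\,dx\Big).$$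 Let $v_1$ and $v_2$ be two solutions in the energy space. Then either $v_1=v_2$ (that is, $v_1(t)=v_2(t)$ in $L^2(\mathbb R^d)$ for all $t\in\mathbb R$), or there exists $C_2>0$ such that for all $t\ge 0$ $$\|v_1(t)-v_2(t)\|_{L^2(\mathbb R^d)}\ \ge\ C_2\,e^{-2\lambda t}.$$ -/

import Mathlib

open MeasureTheory Filter Topology
open scoped ENNReal ContDiff Laplacian

noncomputable section

namespace LogNLS

/-- The space `L²(ℝᵈ; ℂ)`. -/
abbrev L2 (d : ℕ) : Type := Lp ℂ 2 (volume : Measure (EuclideanSpace ℝ (Fin d)))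

/-- The complex-valued test functions on `ℝᵈ`: smooth and compactly supported. -/
structure IsTestFunction {d : ℕ} (φ : EuclideanSpace ℝ (Fin d) → ℂ) : Prop where
  contDiff : ContDiff ℝ ∞ φ
  hasCompactSupport : HasCompactSupport φ

/-- `g = (g₁, …, g_d)`, with components in `L²`, is the weak gradient of `u`:
`∫ u ∂ᵢφ = - ∫ gᵢ φ` for every test function `φ` and every `i`. -/
def IsWeakGradient {d : ℕ} (u : L2 d) (g : Fin d → L2 d) : Prop :=
  ∀ φ : EuclideanSpace ℝ (Fin d) → ℂ, IsTestFunction φ → ∀ i : Fin d,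
    ∫ x, u x * fderiv ℝ φ x (EuclideanSpace.single i 1) = -∫ x, g i x * φ x

/-- Membership in the Sobolev space `H¹(ℝᵈ)`. -/
def MemH1 {d : ℕ} (u : L2 d) : Prop := ∃ g : Fin d → L2 d, IsWeakGradient u g

/-- The `H¹` norm `(‖u‖² + ∑ᵢ ‖∂ᵢu‖²)^{1/2}`, with value `∞` outside `H¹`.
Weak gradients are unique, so the infimum is over at most one value. -/
def h1Norm {d : ℕ} (u : L2 d) : ℝ≥0∞ :=
  ⨅ (g : Fin d → L2 d) (_ : IsWeakGradient u g),
    ENNReal.ofReal (Real.sqrt (‖u‖ ^ 2 + ∑ i, ‖g i‖ ^ 2))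

/-- The energy space `W(ℝᵈ) = {v ∈ H¹(ℝᵈ) : |v|² ln |v|² ∈ L¹(ℝᵈ)}`. -/
def energySpace (d : ℕ) : Set (L2 d) :=
  {v | MemH1 v ∧
    Integrable (fun x : EuclideanSpace ℝ (Fin d) => ‖v x‖ ^ 2 * Real.log (‖v x‖ ^ 2)) volume}

/-- Cazenave's convex Young function: it equals `-s² ln s²` near `0`, and is continued from
`e⁻³` on by a quadratic polynomial in a `C¹` way. -/
def young (s : ℝ) : ℝ :=
  if s ≤ Real.exp (-3) then -(s ^ 2 * Real.log (s ^ 2))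
  else 3 * s ^ 2 + 4 * Real.exp (-3) * s - Real.exp (-6)

/-- The Luxemburg norm `inf {k > 0 : ∫ A(|u| / k) dx ≤ 1}` of the Orlicz space of the
function `A = young`. -/
def luxemburgNorm {d : ℕ} (u : L2 d) : ℝ≥0∞ :=
  ⨅ (k : ℝ) (_ : 0 < k)
    (_ : ∫⁻ x : EuclideanSpace ℝ (Fin d), ENNReal.ofReal (young (‖u x‖ / k)) ≤ 1),
      ENNReal.ofReal k

/-- The (Luxemburg type) norm of the energy space `W(ℝᵈ)`. -/
def energyNorm {d : ℕ} (u : L2 d) : ℝ≥0∞ := h1Norm u + luxemburgNorm u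

/-- `u` is a global solution in the energy space of
`i ∂ₜu + ½ Δu + lam u ln |u|² = 0` on `ℝ × ℝᵈ`: it belongs to `C(ℝ, W(ℝᵈ))`, and at every time
`∂ₜu = i (½ Δu + lam u ln |u|²)` in the sense of distributions on `ℝᵈ`.
(`Real.log 0 = 0`, so that `u ln |u|²` vanishes where `u` does.) -/
structure IsSolution {d : ℕ} (lam : ℝ) (u : ℝ → L2 d) : Prop where
  mem_energySpace : ∀ t : ℝ, u t ∈ energySpace d
  continuous_energyNorm : ∀ s : ℝ, Tendsto (fun t => energyNorm (u t - u s)) (𝓝 s) (𝓝 0)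
  equation : ∀ φ : EuclideanSpace ℝ (Fin d) → ℂ, IsTestFunction φ → ∀ t : ℝ,
    HasDerivAt (fun s : ℝ => ∫ x, u s x * φ x)
      (Complex.I * ((1 / 2) * (∫ x, u t x * Δ φ x)
        + lam * ∫ x, u t x * (Real.log (‖u t x‖ ^ 2) : ℂ) * φ x)) t

end LogNLS

end

noncomputable section

namespace LogNLS

open scoped Convolution

/-! Let `w = v₁ - v₂`. Formally, pairing the equation for `w` with `w` in `L²` makes the Laplacian
term real, so it drops out of the evolution of `‖w‖²`. The Cazenave–Haraux inequality
(`abs_im_logNonlinearity_sub_le`) bounds the remaining term although `z ln |z|²` is not Lipschitz at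
`0`. Hence `|d/dt ‖w‖²| ≤ 4λ ‖w‖²`. Grönwall in both time directions shows that `w` either vanishes
identically or decays no faster than `e^{-2λt}`.

The difficulty is that the equation holds only against fixed smooth test functions, so `w` itself is
not admissible. For fixed `s` and `t`, polarization gives `‖w t‖² - ‖w s‖² = Re ⟨w s + w t, w t - w
s⟩`, where the first entry is constant in time. It is replaced by a test function `φ` close to it in
the energy space (`exists_testFunction_near`), and the mean value inequality is applied to `r ↦ Re
⟨φ, w r⟩`. For `τ` near `s`, `φ` is close to `2 w τ`, so the formal computation holds at `τ` up to a
small error (`abs_re_tested_equation_le`).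

The error in the nonlinear term is a pairing of `v ln |v|²` with a function small in `L²` and in the
Orlicz space. Where `|v|` is small this is Orlicz duality; where `|v|` is large it needs slightly
more than `L²`, namely `L^{2q}` with some `q > 1`, from a Sobolev embedding
(`exists_log_pairing_le`, `exists_sobolev_exponent`). Continuity in time with values in the energy
space makes these bounds uniform for `τ` near `s`. -/

/-! ### Elementary inequalities for the Young function -/

theorem log_sq_le_neg_six {s : ℝ} (h0 : 0 < s) (h : s ≤ Real.exp (-3)) :
    Real.log (s ^ 2) ≤ -6 := by
  rw [Real.log_pow]
  have := (Real.log_le_iff_le_exp h0).2 h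
  push_cast
  linarith

theorem exp_neg_six : Real.exp (-6) = Real.exp (-3) ^ 2 := by
  rw [← Real.exp_nat_mul]; norm_num

@[simp] theorem young_zero : young 0 = 0 := by
  simp [young, (Real.exp_pos (-3)).le]

theorem young_of_le {s : ℝ} (h : s ≤ Real.exp (-3)) :
    young s = -(s ^ 2 * Real.log (s ^ 2)) := by simp [young, h]

theorem young_of_ge {s : ℝ} (h : Real.exp (-3) ≤ s) :
    young s = 3 * s ^ 2 + 4 * Real.exp (-3) * s - Real.exp (-6) := by
  rcases h.eq_or_lt with rfl | h
  · rw [young_of_le le_rfl, exp_neg_six, Real.log_pow, Real.log_exp]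
    push_cast; ring
  · simp [young, h.not_ge]

theorem three_mul_sq_le_young {s : ℝ} (hs : 0 ≤ s) : 3 * s ^ 2 ≤ young s := by
  rcases le_total s (Real.exp (-3)) with h | h
  · rw [young_of_le h]
    rcases hs.eq_or_lt with rfl | h0
    · simp
    · nlinarith [log_sq_le_neg_six h0 h, sq_nonneg s]
  · rw [young_of_ge h, exp_neg_six]
    nlinarith [Real.exp_pos (-3)]

theorem young_nonneg {s : ℝ} (hs : 0 ≤ s) : 0 ≤ young s :=
  (by positivity : (0 : ℝ) ≤ 3 * s ^ 2).trans (three_mul_sq_le_young hs)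

/-- Below `e⁻³` the increase of `s²`, weighted by `-log b² ≥ 6`, outweighs the loss from the
logarithm, since `a² (log b² - log a²) ≤ b² - a²`. -/
theorem young_mono {a b : ℝ} (ha : 0 ≤ a) (hab : a ≤ b) : young a ≤ young b := by
  have small : ∀ {a b : ℝ}, 0 ≤ a → a ≤ b → b ≤ Real.exp (-3) → young a ≤ young b := by
    intro a b ha hab hb
    rcases ha.eq_or_lt with rfl | h0
    · simpa using young_nonneg hab
    have hb0 : 0 < b := h0.trans_le hab
    rw [young_of_le (hab.trans hb), young_of_le hb]
    have h1 := log_sq_le_neg_six hb0 hb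
    have h2 : Real.log (b ^ 2) - Real.log (a ^ 2) ≤ b ^ 2 / a ^ 2 - 1 := by
      rw [← Real.log_div (by positivity) (by positivity)]
      exact Real.log_le_sub_one_of_pos (by positivity)
    have h3 : a ^ 2 * (b ^ 2 / a ^ 2 - 1) = b ^ 2 - a ^ 2 := by field_simp
    have h4 := mul_le_mul_of_nonneg_left h2 (sq_nonneg a)
    nlinarith [mul_self_le_mul_self ha hab]
  have large : ∀ {a b : ℝ}, a ≤ b → Real.exp (-3) ≤ a → young a ≤ young b := by
    intro a b hab h
    rw [young_of_ge h, young_of_ge (h.trans hab)]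
    nlinarith [Real.exp_pos (-3)]
  rcases le_total b (Real.exp (-3)) with hb | hb
  · exact small ha hab hb
  rcases le_total a (Real.exp (-3)) with h | h
  · exact (small ha h le_rfl).trans (large hb le_rfl)
  · exact large hab h

theorem young_le_of_ge {s : ℝ} (h : Real.exp (-3) ≤ s) : young s ≤ 7 * s ^ 2 := by
  rw [young_of_ge h]
  nlinarith [Real.exp_pos (-3), Real.exp_pos (-6)]

/-- The doubling condition. For small `s` the factor is `4`; otherwise `young (2s) ≤ 28 s²` and `3
s² ≤ young s` give `28/3 < 10`. -/
theorem young_two_mul_le {s : ℝ} (hs : 0 ≤ s) : young (2 * s) ≤ 10 * young s := by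
  rcases hs.eq_or_lt with rfl | h0
  · simp
  rcases le_total (2 * s) (Real.exp (-3)) with h | h
  · rw [young_of_le h, young_of_le (by linarith), mul_pow,
      Real.log_mul (by norm_num) (by positivity)]
    have h1 : 0 ≤ Real.log (2 ^ 2) := Real.log_nonneg (by norm_num)
    have h2 := log_sq_le_neg_six h0 (by linarith)
    nlinarith [mul_nonneg (sq_nonneg s) h1, sq_nonneg s]
  · nlinarith [young_le_of_ge h, three_mul_sq_le_young hs]

theorem young_add_le {a b : ℝ} (ha : 0 ≤ a) (hb : 0 ≤ b) :
    young (a + b) ≤ 10 * (young a + young b) := by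
  have key : ∀ {a b : ℝ}, 0 ≤ a → a ≤ b → young (a + b) ≤ 10 * (young a + young b) := by
    intro a b ha hab
    have h1 := young_mono (add_nonneg ha (ha.trans hab)) (by linarith : a + b ≤ 2 * b)
    linarith [young_two_mul_le (ha.trans hab), young_nonneg ha]
  rcases le_total a b with h | h
  · exact key ha h
  · rw [add_comm a, add_comm (young a)]; exact key hb h

theorem young_le_add_sq {s : ℝ} (hs : 0 ≤ s) : young s ≤ 2 * s + 7 * s ^ 2 := by
  rcases le_total s (Real.exp (-3)) with h | h
  · rcases hs.eq_or_lt with rfl | h0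
    · simp
    rw [young_of_le h, Real.log_pow]
    have h1 : -Real.log s ≤ s⁻¹ := by
      rw [← Real.log_inv]
      linarith [Real.log_le_sub_one_of_pos (inv_pos.2 h0)]
    have h2 : s ^ 2 * s⁻¹ = s := by field_simp
    have h3 := mul_le_mul_of_nonneg_left h1 (sq_nonneg s)
    push_cast
    nlinarith [sq_nonneg s]
  · linarith [young_le_of_ge h]

/-- The linear term `2s` is split by the arithmetic–geometric mean inequality. On a set of finite
measure the constant `η` costs little, so the modular is controlled by the `L²` norm there. -/
theorem young_le_const_add_sq {s η : ℝ} (hs : 0 ≤ s) (hη : 0 < η) :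
    young s ≤ η + (7 + η⁻¹) * s ^ 2 := by
  have h1 : 2 * s ≤ η + η⁻¹ * s ^ 2 := by
    have : 0 ≤ η⁻¹ * (s - η) ^ 2 := by positivity
    have h2 : η⁻¹ * (s - η) ^ 2 = η⁻¹ * s ^ 2 - 2 * s + η := by
      field_simp; ring
    linarith
  linarith [young_le_add_sq hs]

theorem young_le_abs_log (s : ℝ) :
    young s ≤ |s ^ 2 * Real.log (s ^ 2)| + 7 * s ^ 2 := by
  rcases le_total s (Real.exp (-3)) with h | h
  · rw [young_of_le h]
    nlinarith [neg_le_abs (s ^ 2 * Real.log (s ^ 2)), sq_nonneg s]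
  · linarith [young_le_of_ge h, abs_nonneg (s ^ 2 * Real.log (s ^ 2))]

theorem measurable_young : Measurable young := by
  unfold young
  exact Measurable.ite measurableSet_Iic (by fun_prop) (by fun_prop)

/-- A Young type inequality for the pairing with the logarithmic nonlinearity. -/
theorem exists_log_pairing_le {q : ℝ} (hq : 1 < q) : ∃ C : ℝ, 0 < C ∧ ∀ s r : ℝ, 0 ≤ s → 0 ≤ r →
    |s * Real.log (s ^ 2)| * r ≤ C * (young s + s ^ (2 * q)) + (2 * young r + r ^ 2) := by
  -- For `s ≥ e⁻³` the product is split into squares: `(log s²)² ≤ 36` on `[e⁻³, 1]`, and `log s ≤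
  -- s^(q-1)/(q-1)` beyond `1` gives `4/(q-1)²`. For `s ≤ e⁻³` the bound `young s + 2 young r`
  -- already suffices.
  refine ⟨36 + 4 / (q - 1) ^ 2, by positivity, fun s r hs hr => ?_⟩
  have hC : (36 : ℝ) ≤ 36 + 4 / (q - 1) ^ 2 := by
    have : 0 ≤ 4 / (q - 1) ^ 2 := by positivity
    linarith
  have hp : 0 ≤ s ^ (2 * q) := Real.rpow_nonneg hs _
  have hys := young_nonneg hs
  have hyr := young_nonneg hr
  rcases hs.eq_or_lt with rfl | h0
  · simp only [zero_mul, abs_zero]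
    positivity
  rcases le_total s (Real.exp (-3)) with h | h
  · have hl := log_sq_le_neg_six h0 h
    have habs : |s * Real.log (s ^ 2)| = -(s * Real.log (s ^ 2)) :=
      abs_of_nonpos (by nlinarith)
    rw [habs]
    suffices -(s * Real.log (s ^ 2)) * r ≤ young s + 2 * young r by nlinarith [sq_nonneg r]
    rcases le_total r s with hrs | hrs
    · rw [young_of_le h]
      nlinarith [mul_nonneg h0.le (neg_nonneg.2 (by linarith : Real.log (s ^ 2) ≤ 0))]
    · have hr0 := h0.trans_le hrs
      -- `-s log s²` is at most `-t log t²` for `t = min r e⁻³`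
      have mono : ∀ t, s ≤ t → t ≤ Real.exp (-3) →
          -(s * Real.log (s ^ 2)) ≤ -(t * Real.log (t ^ 2)) := by
        intro t hst ht
        have ht0 := h0.trans_le hst
        have h1 := log_sq_le_neg_six ht0 ht
        have h2 : Real.log (t ^ 2) - Real.log (s ^ 2) ≤ 2 * (t / s - 1) := by
          rw [Real.log_pow, Real.log_pow, ← mul_sub, ← Real.log_div ht0.ne' h0.ne']
          push_cast
          linarith [Real.log_le_sub_one_of_pos (div_pos ht0 h0)]
        have h3 : s * (2 * (t / s - 1)) = 2 * (t - s) := by field_simp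
        have h4 := mul_le_mul_of_nonneg_left h2 h0.le
        nlinarith
      rcases le_total r (Real.exp (-3)) with hr3 | hr3
      · have := mul_le_mul_of_nonneg_right (mono r hrs hr3) hr
        have h5 := young_of_le hr3
        nlinarith
      · have h5 := mul_le_mul_of_nonneg_right (mono _ h le_rfl) hr
        rw [Real.log_pow (Real.exp (-3)) 2, Real.log_exp] at h5
        push_cast at h5
        have h6 := three_mul_sq_le_young hr
        nlinarith [mul_le_mul_of_nonneg_right hr3 hr]
  · suffices (s * Real.log (s ^ 2)) ^ 2 ≤ (36 + 4 / (q - 1) ^ 2) * (young s + s ^ (2 * q)) by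
      nlinarith [sq_nonneg (|s * Real.log (s ^ 2)| - r), sq_abs (s * Real.log (s ^ 2)),
        sq_nonneg r, sq_nonneg (s * Real.log (s ^ 2))]
    have hy := three_mul_sq_le_young hs
    rcases le_total s 1 with h1 | h1
    · have hl : -6 ≤ Real.log (s ^ 2) := by
        rw [Real.log_pow]
        have := (Real.le_log_iff_exp_le h0).2 h
        push_cast; linarith
      have hl' : Real.log (s ^ 2) ≤ 0 := Real.log_nonpos (by positivity) (by nlinarith)
      have : Real.log (s ^ 2) ^ 2 ≤ 36 := by nlinarith
      rw [mul_pow]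
      have := mul_le_mul_of_nonneg_left this (sq_nonneg s)
      nlinarith
    · have hl : Real.log s ≤ s ^ (q - 1) / (q - 1) := Real.log_le_rpow_div hs (by linarith)
      have hl0 : 0 ≤ Real.log s := Real.log_nonneg h1
      have h2 : Real.log s ^ 2 ≤ (s ^ (q - 1) / (q - 1)) ^ 2 := pow_le_pow_left₀ hl0 hl 2
      have h3 : s ^ 2 * (s ^ (q - 1)) ^ 2 = s ^ (2 * q) := by
        rw [← mul_pow, mul_comm 2 q, Real.rpow_mul hs, Real.rpow_two]
        congr 1
        rw [← Real.rpow_one_add' hs (by linarith)]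
        congr 1; ring
      have h4 : (s * Real.log (s ^ 2)) ^ 2 = 4 * (s ^ 2 * Real.log s ^ 2) := by
        rw [Real.log_pow]; push_cast; ring
      have h5 : s ^ 2 * Real.log s ^ 2 ≤ 1 / (q - 1) ^ 2 * s ^ (2 * q) := by
        rw [← h3]
        calc _ ≤ s ^ 2 * (s ^ (q - 1) / (q - 1)) ^ 2 := by gcongr
          _ = _ := by rw [div_pow]; ring
      rw [h4]
      have h6 : 4 / (q - 1) ^ 2 = 4 * (1 / (q - 1) ^ 2) := by ring
      have h7 : 0 ≤ 4 / (q - 1) ^ 2 := by positivity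
      nlinarith [mul_nonneg h7 hys]

/-! ### The logarithmic nonlinearity -/

/-- The logarithmic nonlinearity `z ln |z|²`. -/
def logNonlinearity (z : ℂ) : ℂ := z * (Real.log (‖z‖ ^ 2) : ℂ)

theorem measurable_logNonlinearity : Measurable logNonlinearity := by
  unfold logNonlinearity
  fun_prop

theorem norm_logNonlinearity (z : ℂ) :
    ‖logNonlinearity z‖ = |‖z‖ * Real.log (‖z‖ ^ 2)| := by
  rw [logNonlinearity, norm_mul, Complex.norm_real, Real.norm_eq_abs, abs_mul, abs_norm]

/-- The Cazenave–Haraux inequality. -/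
theorem abs_im_logNonlinearity_sub_le (z w : ℂ) :
    |((logNonlinearity z - logNonlinearity w) * (starRingEnd ℂ) (z - w)).im| ≤ 2 * ‖z - w‖ ^ 2 := by
  have key : ∀ z w : ℂ, ‖z‖ ≤ ‖w‖ →
      |((logNonlinearity z - logNonlinearity w) * (starRingEnd ℂ) (z - w)).im|
        ≤ 2 * ‖z - w‖ ^ 2 := by
    intro z w h
    -- The difference of nonlinearities is `(z - w) log |w|²` plus `z (log |z|² - log |w|²)`; the
    -- first summand times `conj (z - w)` is real. In what remains, the smaller modulus `‖z‖`
    -- cancels the `1/‖z‖` from the logarithmic increment.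
    have him : ((logNonlinearity z - logNonlinearity w) * (starRingEnd ℂ) (z - w)).im
        = (z * (starRingEnd ℂ) (w - z)).im * (Real.log (‖w‖ ^ 2) - Real.log (‖z‖ ^ 2)) := by
      simp only [logNonlinearity, Complex.mul_im, Complex.sub_im, Complex.sub_re, Complex.conj_re,
        Complex.conj_im, Complex.mul_re, Complex.ofReal_re, Complex.ofReal_im]
      ring
    rw [him, abs_mul]
    rcases (norm_nonneg z).eq_or_lt with h0 | h0
    · have : z = 0 := norm_eq_zero.1 h0.symm
      subst this
      simp
    have h1 : |(z * (starRingEnd ℂ) (w - z)).im| ≤ ‖z‖ * ‖z - w‖ := by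
      refine (Complex.abs_im_le_norm _).trans ?_
      rw [norm_mul, RCLike.norm_conj, norm_sub_rev]
    have hw := h0.trans_le h
    have h2 : |Real.log (‖w‖ ^ 2) - Real.log (‖z‖ ^ 2)| ≤ 2 * (‖z - w‖ / ‖z‖) := by
      rw [Real.log_pow, Real.log_pow, ← mul_sub, ← Real.log_div hw.ne' h0.ne', abs_of_nonneg]
      · push_cast
        have h3 := Real.log_le_sub_one_of_pos (div_pos hw h0)
        have h4 : ‖w‖ / ‖z‖ - 1 ≤ ‖z - w‖ / ‖z‖ := by
          rw [div_sub_one h0.ne']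
          gcongr
          rw [norm_sub_rev]; exact norm_sub_norm_le _ _
        linarith
      · have : 0 ≤ Real.log (‖w‖ / ‖z‖) := Real.log_nonneg ((one_le_div h0).2 h)
        positivity
    calc _ ≤ (‖z‖ * ‖z - w‖) * (2 * (‖z - w‖ / ‖z‖)) := by gcongr
      _ = _ := by field_simp
  rcases le_total ‖z‖ ‖w‖ with h | h
  · exact key z w h
  · have := key w z h
    rw [norm_sub_rev z w]
    convert this using 2
    rw [← neg_sub (logNonlinearity w), ← neg_sub w z, map_neg, neg_mul_neg]

/-! ### Mollification in `L²` -/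

theorem eLpNorm_two_sq {α F : Type*} [MeasurableSpace α] [NormedAddCommGroup F] (μ : Measure α)
    (f : α → F) : eLpNorm f 2 μ ^ 2 = ∫⁻ x, ‖f x‖ₑ ^ 2 ∂μ := by
  have := eLpNorm_nnreal_pow_eq_lintegral (μ := μ) (f := f) (p := 2) two_ne_zero
  simpa using this

/-- Cauchy–Schwarz for `ρ h = ρ^(1/2) (ρ h²)^(1/2)`; with `ρ` of mass one it is Jensen's inequality
for averages. -/
theorem lintegral_mul_sq_le {α : Type*} [MeasurableSpace α] {μ : Measure α} {ρ h : α → ℝ≥0∞}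
    (hρ : Measurable ρ) (hh : Measurable h) :
    (∫⁻ x, ρ x * h x ∂μ) ^ 2 ≤ (∫⁻ x, ρ x ∂μ) * ∫⁻ x, ρ x * h x ^ 2 ∂μ := by
  have h1 := ENNReal.lintegral_mul_norm_pow_le (μ := μ) (f := ρ) (g := fun x => ρ x * h x ^ 2)
    hρ.aemeasurable (by fun_prop) (p := 1 / 2) (q := 1 / 2) (by norm_num) (by norm_num)
    (by norm_num)
  have h2 : ∀ x, ρ x ^ (1 / 2 : ℝ) * (ρ x * h x ^ 2) ^ (1 / 2 : ℝ) = ρ x * h x := by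
    intro x
    rw [ENNReal.mul_rpow_of_nonneg _ _ (by norm_num), ← mul_assoc,
      ← ENNReal.rpow_add_of_nonneg _ _ (by norm_num) (by norm_num), ← ENNReal.rpow_two,
      ← ENNReal.rpow_mul]
    norm_num
  simp_rw [h2] at h1
  calc _ ≤ _ := pow_le_pow_left₀ (by positivity) h1 2
    _ = _ := by
      rw [mul_pow, ← ENNReal.rpow_two, ← ENNReal.rpow_two, ← ENNReal.rpow_mul, ← ENNReal.rpow_mul]
      norm_num

theorem exists_translation_le {d : ℕ} (g : L2 d) {ε : ℝ≥0∞} (hε : 0 < ε) :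
    ∃ δ : ℝ, 0 < δ ∧ ∀ y : EuclideanSpace ℝ (Fin d), ‖y‖ ≤ δ →
      eLpNorm (fun x => g (x - y) - g x) 2 volume ≤ ε := by
  let E := EuclideanSpace ℝ (Fin d)
  let T : E → C(E, E) := fun y => ⟨fun x => x - y, by fun_prop⟩
  have hT : Continuous T :=
    ContinuousMap.continuous_of_continuous_uncurry _ (by
      change Continuous fun p : E × E => p.2 - p.1
      fun_prop)
  have hTm : ∀ y, MeasurePreserving (T y) volume volume := fun y => measurePreserving_sub_right _ y
  have hc := Continuous.compMeasurePreservingLp (f := fun _ : E => g) continuous_const hT hTm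
    ENNReal.ofNat_ne_top
  have h0 : Lp.compMeasurePreserving (T 0) (hTm 0) g = g := by
    apply Lp.ext
    filter_upwards [Lp.coeFn_compMeasurePreserving g (hTm 0)] with x hx
    rw [hx]; simp [T]
  have hev := (EMetric.tendsto_nhds.1 (hc.tendsto 0)) ε hε
  obtain ⟨δ, hδ, hδ'⟩ := Metric.eventually_nhds_iff.1 hev
  refine ⟨δ / 2, by positivity, fun y hy => ?_⟩
  have := hδ' (y := y) (by rw [dist_zero_right]; linarith)
  rw [h0, Lp.edist_def] at this
  refine le_of_eq_of_le (eLpNorm_congr_ae ?_) this.le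
  filter_upwards [Lp.coeFn_compMeasurePreserving g (hTm y)] with x hx
  have hx' : Lp.compMeasurePreserving (T y) (hTm y) g x = g (x - y) := hx
  rw [Pi.sub_apply, hx']

theorem locallyIntegrable_L2 {d : ℕ} (g : L2 d) : LocallyIntegrable g volume :=
  (Lp.memLp g).locallyIntegrable (by norm_num)

/-- The error is an average of `g (x - y) - g x` over `y` in the support of the bump, so Jensen and
Tonelli reduce it to continuity of translations. Only the outer radius of the bump matters, so one
bump can serve a function and all its derivatives. -/
theorem exists_convolution_sub_le {d : ℕ} (g : L2 d) {ε : ℝ≥0∞} (hε : 0 < ε) :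
    ∃ δ : ℝ, 0 < δ ∧ ∀ f : ContDiffBump (0 : EuclideanSpace ℝ (Fin d)), f.rOut ≤ δ →
      eLpNorm (fun x => (f.normed volume ⋆[ContinuousLinearMap.lsmul ℝ ℝ, volume] g) x - g x)
        2 volume ≤ ε := by
  obtain ⟨δ, hδ, h⟩ := exists_translation_le g hε
  refine ⟨δ, hδ, fun f hf => ?_⟩
  set ρ := f.normed volume with hρ
  have hρc : Continuous ρ := f.continuous_normed
  have hgm : Measurable g := (Lp.stronglyMeasurable g).measurable
  have hρ1 : ∫⁻ y, ‖ρ y‖ₑ = 1 := by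
    have h1 : ∀ y, ‖ρ y‖ₑ = ENNReal.ofReal (ρ y) := fun y =>
      Real.enorm_of_nonneg (f.nonneg_normed y)
    simp_rw [h1]
    rw [← ofReal_integral_eq_lintegral_ofReal f.integrable_normed
      (Eventually.of_forall f.nonneg_normed), f.integral_normed, ENNReal.ofReal_one]
  have hpt : ∀ x, ‖(ρ ⋆[ContinuousLinearMap.lsmul ℝ ℝ, volume] g) x - g x‖ₑ ^ 2
      ≤ ∫⁻ y, ‖ρ y‖ₑ * ‖g (x - y) - g x‖ₑ ^ 2 := by
    intro x
    have hint : Integrable (fun y => ρ y • g (x - y)) :=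
      (f.hasCompactSupport_normed.convolutionExists_left (ContinuousLinearMap.lsmul ℝ ℝ) hρc
        (locallyIntegrable_L2 g) x).integrable
    have heq : (ρ ⋆[ContinuousLinearMap.lsmul ℝ ℝ, volume] g) x - g x
        = ∫ y, ρ y • (g (x - y) - g x) := by
      simp_rw [smul_sub]
      rw [integral_sub hint (f.integrable_normed.smul_const _), f.integral_normed_smul,
        convolution_lsmul]
    rw [heq]
    calc _ ≤ (∫⁻ y, ‖ρ y‖ₑ * ‖g (x - y) - g x‖ₑ) ^ 2 := by
          gcongr
          refine (enorm_integral_le_lintegral_enorm _).trans_eq ?_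
          simp_rw [enorm_smul]
      _ ≤ _ := lintegral_mul_sq_le (by fun_prop) (by fun_prop)
      _ = _ := by rw [hρ1, one_mul]
  have hsq : eLpNorm (fun x => (ρ ⋆[ContinuousLinearMap.lsmul ℝ ℝ, volume] g) x - g x)
        2 volume ^ 2 ≤ ε ^ 2 := by
    rw [eLpNorm_two_sq]
    calc _ ≤ ∫⁻ x, ∫⁻ y, ‖ρ y‖ₑ * ‖g (x - y) - g x‖ₑ ^ 2 := lintegral_mono hpt
      _ = ∫⁻ y, ∫⁻ x, ‖ρ y‖ₑ * ‖g (x - y) - g x‖ₑ ^ 2 := by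
        apply lintegral_lintegral_swap
        apply Measurable.aemeasurable
        have hρm : Measurable ρ := hρc.measurable
        change Measurable fun p : EuclideanSpace ℝ (Fin d) × EuclideanSpace ℝ (Fin d) =>
          ‖ρ p.2‖ₑ * ‖g (p.1 - p.2) - g p.1‖ₑ ^ 2
        fun_prop
      _ ≤ ∫⁻ y, ‖ρ y‖ₑ * ε ^ 2 := by
        refine lintegral_mono fun y => ?_
        rw [lintegral_const_mul _ (by fun_prop)]
        by_cases hy : ‖y‖ ≤ δ
        · gcongr
          rw [← eLpNorm_two_sq volume (fun x => g (x - y) - g x)]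
          gcongr
          exact h y hy
        · have : ρ y = 0 := by
            rw [← Function.notMem_support, hρ, f.support_normed_eq, mem_ball_zero_iff]
            intro h'; exact hy (h'.le.trans hf)
          simp [this]
      _ = ε ^ 2 := by rw [lintegral_mul_const _ (by fun_prop), hρ1, one_mul]
  rw [← ENNReal.rpow_two, ← ENNReal.rpow_two] at hsq
  exact (ENNReal.rpow_le_rpow_iff two_pos).1 hsq

theorem IsTestFunction.continuous {d : ℕ} {φ : EuclideanSpace ℝ (Fin d) → ℂ}
    (hφ : IsTestFunction φ) : Continuous φ := hφ.contDiff.continuous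

theorem IsTestFunction.memLp {d : ℕ} {φ : EuclideanSpace ℝ (Fin d) → ℂ}
    (hφ : IsTestFunction φ) : MemLp φ 2 volume :=
  hφ.continuous.memLp_of_hasCompactSupport hφ.hasCompactSupport

/-- The `i`-th partial derivative. -/
def partialDeriv {d : ℕ} (φ : EuclideanSpace ℝ (Fin d) → ℂ) (i : Fin d) :
    EuclideanSpace ℝ (Fin d) → ℂ :=
  fun x => fderiv ℝ φ x (EuclideanSpace.single i 1)

theorem IsTestFunction.partialDeriv {d : ℕ} {φ : EuclideanSpace ℝ (Fin d) → ℂ}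
    (hφ : IsTestFunction φ) (i : Fin d) : IsTestFunction (partialDeriv φ i) where
  contDiff := (hφ.contDiff.fderiv_right (m := ∞) (by simp)).clm_apply contDiff_const
  hasCompactSupport := hφ.hasCompactSupport.fderiv_apply (𝕜 := ℝ) _

theorem contDiff_convolution_L2 {d : ℕ} (f : ContDiffBump (0 : EuclideanSpace ℝ (Fin d)))
    (g : L2 d) :
    ContDiff ℝ ∞ (f.normed volume ⋆[ContinuousLinearMap.lsmul ℝ ℝ, volume] g) :=
  f.hasCompactSupport_normed.contDiff_convolution_left (n := ⊤) _ f.contDiff_normed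
    (locallyIntegrable_L2 g)

/-- Differentiation falls on the mollifier, and `y ↦ ρ (x - y)` is a test function for the weak
gradient; the sign of the reflection cancels the sign of the integration by parts. -/
theorem fderiv_convolution_apply {d : ℕ} (f : ContDiffBump (0 : EuclideanSpace ℝ (Fin d)))
    {u : L2 d} {g : Fin d → L2 d} (hg : IsWeakGradient u g) (i : Fin d)
    (x : EuclideanSpace ℝ (Fin d)) :
    fderiv ℝ (f.normed volume ⋆[ContinuousLinearMap.lsmul ℝ ℝ, volume] u) x
      (EuclideanSpace.single i 1)
      = (f.normed volume ⋆[ContinuousLinearMap.lsmul ℝ ℝ, volume] g i) x := by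
  set ρ := f.normed volume with hρ
  have hρs : ContDiff ℝ ∞ ρ := f.contDiff_normed (n := ⊤)
  have hρd : Differentiable ℝ ρ := hρs.differentiable (by simp)
  have hcs : HasCompactSupport ρ := f.hasCompactSupport_normed
  have hex := ((hcs.fderiv ℝ).convolutionExists_left
    ((ContinuousLinearMap.lsmul ℝ ℝ : ℝ →L[ℝ] ℂ →L[ℝ] ℂ).precompL (EuclideanSpace ℝ (Fin d)))
    (hρs.continuous_fderiv (by simp)) (locallyIntegrable_L2 u) x)
  rw [(hcs.hasFDerivAt_convolution_left _ (hρs.of_le (by simp)) (locallyIntegrable_L2 u) x).fderiv]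
  have hφ : IsTestFunction (fun y => ((ρ (x - y) : ℝ) : ℂ)) := by
    refine ⟨Complex.ofRealCLM.contDiff.comp (hρs.comp (contDiff_const.sub contDiff_id)), ?_⟩
    have h1 : HasCompactSupport (fun y => ρ (x - y)) :=
      hcs.comp_homeomorph (Homeomorph.subLeft x)
    exact h1.comp_left (g := fun r : ℝ => (r : ℂ)) Complex.ofReal_zero
  have hd : ∀ y, fderiv ℝ (fun y => ((ρ (x - y) : ℝ) : ℂ)) y (EuclideanSpace.single i 1)
      = -((fderiv ℝ ρ (x - y) (EuclideanSpace.single i 1) : ℝ) : ℂ) := by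
    intro y
    have h1 : HasFDerivAt (fun y => x - y)
        (-(ContinuousLinearMap.id ℝ (EuclideanSpace ℝ (Fin d)))) y :=
      (hasFDerivAt_id y).const_sub x
    have h2 := (Complex.ofRealCLM.hasFDerivAt (x := ρ (x - y))).comp y
      ((hρd (x - y)).hasFDerivAt.comp y h1)
    have h3 : HasFDerivAt (fun y => ((ρ (x - y) : ℝ) : ℂ)) _ y := h2
    rw [h3.fderiv]
    simp
  have hw := hg _ hφ i
  simp_rw [hd, mul_neg] at hw
  rw [integral_neg, neg_inj] at hw
  rw [convolution_def, ContinuousLinearMap.integral_apply hex.integrable]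
  simp only [ContinuousLinearMap.precompL_apply, ContinuousLinearMap.lsmul_apply]
  rw [convolution_eq_swap, ← integral_sub_left_eq_self _ volume x]
  simp only [sub_sub_cancel, ContinuousLinearMap.lsmul_apply, Complex.real_smul]
  simp_rw [mul_comm ((_ : ℝ) : ℂ)]
  exact hw

/-! ### Young modular, cutoffs and density of test functions -/

theorem exists_young_mul_le (c : ℝ) : ∃ K : ℝ, 0 ≤ K ∧ ∀ s : ℝ, 0 ≤ s → 0 ≤ c →
    young (c * s) ≤ K * young s := by
  obtain ⟨n, hn⟩ := pow_unbounded_of_one_lt c (one_lt_two (α := ℝ))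
  refine ⟨10 ^ n, by positivity, fun s hs hc => ?_⟩
  have : ∀ n : ℕ, young (2 ^ n * s) ≤ 10 ^ n * young s := by
    intro n
    induction n with
    | zero => simp
    | succ n ih =>
      rw [pow_succ', mul_assoc, pow_succ' (10 : ℝ), mul_assoc]
      exact (young_two_mul_le (by positivity)).trans (by gcongr)
  exact (young_mono (by positivity) (by gcongr)).trans (this n)

theorem lintegral_young_mul_lt_top {α : Type*} [MeasurableSpace α] {μ : Measure α} {f : α → ℝ}
    (hf : ∀ x, 0 ≤ f x) (h : ∫⁻ x, ENNReal.ofReal (young (f x)) ∂μ < ⊤) {c : ℝ} (hc : 0 ≤ c) :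
    ∫⁻ x, ENNReal.ofReal (young (c * f x)) ∂μ < ⊤ := by
  obtain ⟨K, hK, hKs⟩ := exists_young_mul_le c
  calc _ ≤ ∫⁻ x, ENNReal.ofReal K * ENNReal.ofReal (young (f x)) ∂μ := by
        refine lintegral_mono fun x => ?_
        rw [← ENNReal.ofReal_mul hK]
        exact ENNReal.ofReal_le_ofReal (hKs _ (hf x) hc)
    _ < ⊤ := by
        rw [lintegral_const_mul' _ _ ENNReal.ofReal_ne_top]
        exact ENNReal.mul_lt_top ENNReal.ofReal_lt_top h

/-- On a set of finite measure, `L²` convergence implies convergence of the Young modular. -/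
theorem exists_lintegral_young_le {α F : Type*} [MeasurableSpace α] [NormedAddCommGroup F]
    {μ : Measure α} {B : Set α} (hB : MeasurableSet B) (hBf : μ B < ⊤)
    {ε η : ℝ} (hε : 0 < ε) (hη : 0 < η) :
    ∃ κ : ℝ, 0 < κ ∧ ∀ h : α → F, (∀ x ∉ B, h x = 0) → eLpNorm h 2 μ ≤ ENNReal.ofReal κ →
      ∫⁻ x, ENNReal.ofReal (young (‖h x‖ / ε)) ∂μ ≤ ENNReal.ofReal η := by
  set b := (μ B).toReal
  have hb : 0 ≤ b := ENNReal.toReal_nonneg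
  -- Half of `η` is left to the constant term on `B` and half to the `L²` term; `b + 1` keeps the
  -- denominator positive when `B` is null.
  set τ := η / (2 * (b + 1)) with hτ
  have hτ0 : 0 < τ := by positivity
  set K := (7 + τ⁻¹) / ε ^ 2 with hKdef
  have hK : 0 < K := by positivity
  refine ⟨Real.sqrt (η / (2 * K)), by positivity, fun h hsupp hh => ?_⟩
  have hpt : ∀ x, ENNReal.ofReal (young (‖h x‖ / ε))
      ≤ B.indicator (fun _ => ENNReal.ofReal τ) x + ENNReal.ofReal K * ‖h x‖ₑ ^ 2 := by
    intro x
    by_cases hx : x ∈ B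
    · rw [Set.indicator_of_mem hx, ← ofReal_norm, ← ENNReal.ofReal_pow (norm_nonneg _),
        ← ENNReal.ofReal_mul hK.le, ← ENNReal.ofReal_add hτ0.le (by positivity)]
      refine ENNReal.ofReal_le_ofReal ((young_le_const_add_sq (by positivity) hτ0).trans_eq ?_)
      rw [hKdef]; field_simp
    · simp [hsupp x hx]
  calc _ ≤ _ := lintegral_mono hpt
    _ = ENNReal.ofReal τ * μ B + ENNReal.ofReal K * eLpNorm h 2 μ ^ 2 := by
      rw [lintegral_add_left (measurable_const.indicator hB), lintegral_indicator_const hB,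
        lintegral_const_mul' _ _ ENNReal.ofReal_ne_top, eLpNorm_two_sq]
    _ ≤ ENNReal.ofReal τ * ENNReal.ofReal b
        + ENNReal.ofReal K * ENNReal.ofReal (Real.sqrt (η / (2 * K))) ^ 2 := by
      rw [ENNReal.ofReal_toReal hBf.ne]
      gcongr
    _ ≤ _ := by
      rw [← ENNReal.ofReal_pow (Real.sqrt_nonneg _), Real.sq_sqrt (by positivity),
        ← ENNReal.ofReal_mul hτ0.le, ← ENNReal.ofReal_mul hK.le,
        ← ENNReal.ofReal_add (by positivity) (by positivity)]
      apply ENNReal.ofReal_le_ofReal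
      have h1 : K * (η / (2 * K)) = η / 2 := by field_simp
      have h2 : τ * b ≤ η / 2 := by
        rw [hτ, div_mul_eq_mul_div, div_le_div_iff₀ (by positivity) two_pos]
        nlinarith
      linarith

/-- A fixed bump function, equal to `1` on the unit ball. -/
def unitBump (d : ℕ) : ContDiffBump (0 : EuclideanSpace ℝ (Fin d)) := ⟨1, 2, one_pos, one_lt_two⟩

/-- The cutoff at scale `n + 1`. -/
def cutoff (d n : ℕ) (x : EuclideanSpace ℝ (Fin d)) : ℝ := unitBump d ((n + 1 : ℝ)⁻¹ • x)

theorem contDiff_cutoff (d n : ℕ) : ContDiff ℝ ∞ (cutoff d n) :=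
  (unitBump d).contDiff.comp (contDiff_const_smul _)

theorem cutoff_nonneg {d : ℕ} (n : ℕ) (x : EuclideanSpace ℝ (Fin d)) : 0 ≤ cutoff d n x :=
  (unitBump d).nonneg

theorem cutoff_le_one {d : ℕ} (n : ℕ) (x : EuclideanSpace ℝ (Fin d)) : cutoff d n x ≤ 1 :=
  (unitBump d).le_one

theorem cutoff_eq_zero {d n : ℕ} {x : EuclideanSpace ℝ (Fin d)}
    (hx : x ∉ Metric.closedBall 0 (2 * (n + 1 : ℝ))) : cutoff d n x = 0 := by
  apply (unitBump d).zero_of_le_dist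
  rw [mem_closedBall_zero_iff, not_le] at hx
  rw [dist_zero_right, norm_smul, norm_inv, Real.norm_of_nonneg (by positivity : (0 : ℝ) ≤ n + 1),
    inv_mul_eq_div, le_div_iff₀ (by positivity)]
  exact hx.le

theorem eventually_cutoff_eq_one {d : ℕ} (x : EuclideanSpace ℝ (Fin d)) :
    ∀ᶠ n : ℕ in atTop, cutoff d n x = 1 := by
  obtain ⟨N, hN⟩ := exists_nat_ge ‖x‖
  filter_upwards [eventually_ge_atTop N] with n hn
  apply (unitBump d).one_of_mem_closedBall
  have : (N : ℝ) ≤ n := by exact_mod_cast hn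
  rw [mem_closedBall_zero_iff, norm_smul, norm_inv,
    Real.norm_of_nonneg (by positivity : (0 : ℝ) ≤ n + 1), inv_mul_eq_div,
    div_le_iff₀ (by positivity)]
  change ‖x‖ ≤ 1 * _
  linarith

theorem hasCompactSupport_cutoff (d n : ℕ) : HasCompactSupport (cutoff d n) :=
  HasCompactSupport.intro (isCompact_closedBall _ _) fun _ hx => cutoff_eq_zero hx

theorem exists_norm_fderiv_cutoff_le (d : ℕ) : ∃ C : ℝ, 0 ≤ C ∧ ∀ n x,
    ‖fderiv ℝ (cutoff d n) x‖ ≤ C / (n + 1) := by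
  have hs : ContDiff ℝ ∞ (unitBump d) := (unitBump d).contDiff
  obtain ⟨C, hC⟩ := ((unitBump d).hasCompactSupport.fderiv ℝ).exists_bound_of_continuous
    (hs.continuous_fderiv (by simp))
  refine ⟨C, (norm_nonneg _).trans (hC 0), fun n x => ?_⟩
  have h1 : HasFDerivAt (fun x : EuclideanSpace ℝ (Fin d) => (n + 1 : ℝ)⁻¹ • x)
      ((n + 1 : ℝ)⁻¹ • ContinuousLinearMap.id ℝ _) x :=
    ((n + 1 : ℝ)⁻¹ • ContinuousLinearMap.id ℝ (EuclideanSpace ℝ (Fin d))).hasFDerivAt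
  have h2 : HasFDerivAt (cutoff d n) _ x :=
    ((hs.differentiable (by simp)) ((n + 1 : ℝ)⁻¹ • x)).hasFDerivAt.comp x h1
  rw [h2.fderiv, ContinuousLinearMap.comp_smul, ContinuousLinearMap.comp_id, norm_smul, norm_inv,
    Real.norm_of_nonneg (by positivity : (0 : ℝ) ≤ n + 1), inv_mul_eq_div]
  gcongr
  exact hC _

/-- Dominated convergence, with a general monotone `A` so as to cover both the square and the Young
function. -/
theorem tendsto_lintegral_cutoff {d : ℕ} {f : EuclideanSpace ℝ (Fin d) → ℝ}
    {A : ℝ → ℝ} (hA0 : A 0 = 0) (hA : ∀ {a b}, 0 ≤ a → a ≤ b → A a ≤ A b) (hAm : Measurable A)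
    (hfm : Measurable f) (hf : ∀ x, 0 ≤ f x) (h : ∫⁻ x, ENNReal.ofReal (A (f x)) < ⊤) :
    Tendsto (fun n => ∫⁻ x, ENNReal.ofReal (A ((1 - cutoff d n x) * f x))) atTop (𝓝 0) := by
  rw [← lintegral_zero (μ := (volume : Measure (EuclideanSpace ℝ (Fin d))))]
  refine tendsto_lintegral_of_dominated_convergence (fun x => ENNReal.ofReal (A (f x)))
    (fun n => ?_) (fun n => Eventually.of_forall fun x => ?_) h.ne
    (Eventually.of_forall fun x => ?_)
  · have := (contDiff_cutoff d n).continuous.measurable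
    fun_prop
  · have h1 := cutoff_nonneg n x
    have h2 := cutoff_le_one n x
    exact ENNReal.ofReal_le_ofReal (hA (mul_nonneg (by linarith) (hf x)) (by nlinarith [hf x]))
  · refine tendsto_const_nhds.congr' ?_
    filter_upwards [eventually_cutoff_eq_one x] with n hn
    simp [hn, hA0]

theorem tendsto_eLpNorm_cutoff {d : ℕ} (u : L2 d) :
    Tendsto (fun n => eLpNorm (fun x => (1 - cutoff d n x) • u x) 2 volume) atTop (𝓝 0) := by
  have hm : Measurable u := (Lp.stronglyMeasurable u).measurable
  have key : ∀ (f : EuclideanSpace ℝ (Fin d) → ℂ),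
      eLpNorm f 2 volume = (∫⁻ x, ENNReal.ofReal (‖f x‖ ^ 2)) ^ (2⁻¹ : ℝ) := by
    intro f
    simp_rw [ENNReal.ofReal_pow (norm_nonneg _), ofReal_norm]
    rw [← eLpNorm_two_sq, ← ENNReal.rpow_two, ← ENNReal.rpow_mul]
    norm_num
  have hlim := tendsto_lintegral_cutoff (f := fun x => ‖u x‖) (A := fun s => s ^ 2) (by simp)
    (fun ha hab => by gcongr) (by fun_prop) (by fun_prop) (fun x => norm_nonneg _) (by
      simp_rw [ENNReal.ofReal_pow (norm_nonneg _), ofReal_norm]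
      rw [← eLpNorm_two_sq]
      exact ENNReal.pow_lt_top (Lp.memLp u).2)
  have := (ENNReal.continuous_rpow_const (y := (2⁻¹ : ℝ))).tendsto 0 |>.comp hlim
  rw [ENNReal.zero_rpow_of_pos (by norm_num)] at this
  refine this.congr fun n => ?_
  rw [key]
  simp only [Function.comp_apply, norm_smul]
  congr 2
  ext x
  rw [Real.norm_of_nonneg]
  linarith [cutoff_le_one n x]

/-- Test functions are dense in the energy space. -/
theorem exists_testFunction_near {d : ℕ} {u : L2 d} {g : Fin d → L2 d} (hg : IsWeakGradient u g)
    (hA : ∫⁻ x, ENNReal.ofReal (young ‖u x‖) < ⊤) {ε : ℝ} (hε : 0 < ε) :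
    ∃ φ : EuclideanSpace ℝ (Fin d) → ℂ, IsTestFunction φ ∧
      eLpNorm (fun x => φ x - u x) 2 volume ≤ ENNReal.ofReal ε ∧
      (∀ i, eLpNorm (fun x => partialDeriv φ i x - g i x) 2 volume ≤ ENNReal.ofReal ε) ∧
      ∫⁻ x, ENNReal.ofReal (young (‖φ x - u x‖ / ε)) ≤ 1 := by
  have hum : Measurable u := (Lp.stronglyMeasurable u).measurable
  have hgm : ∀ i, Measurable (g i) := fun i => (Lp.stronglyMeasurable (g i)).measurable
  obtain ⟨C, hC, hCb⟩ := exists_norm_fderiv_cutoff_le d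
  have e1 : ∀ᶠ n : ℕ in atTop, eLpNorm (fun x => (1 - cutoff d n x) • u x) 2 volume
      ≤ ENNReal.ofReal (ε / 2) :=
    (tendsto_eLpNorm_cutoff u).eventually_le_const (by positivity)
  have e2 : ∀ᶠ n : ℕ in atTop, ∀ i, eLpNorm (fun x => (1 - cutoff d n x) • g i x) 2 volume
      ≤ ENNReal.ofReal (ε / 3) :=
    eventually_all.2 fun i => (tendsto_eLpNorm_cutoff (g i)).eventually_le_const (by positivity)
  have e3 : ∀ᶠ n : ℕ in atTop, C / (n + 1) * (1 + ‖u‖) ≤ ε / 3 := by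
    have h1 : Tendsto (fun n : ℕ => C / ((n : ℝ) + 1) * (1 + ‖u‖)) atTop (𝓝 (0 * (1 + ‖u‖))) := by
      refine Tendsto.mul_const _ ?_
      exact tendsto_const_nhds.div_atTop (tendsto_atTop_add_const_right _ _
        tendsto_natCast_atTop_atTop)
    rw [zero_mul] at h1
    exact h1.eventually_le_const (by positivity)
  -- The value `1/20` is dictated by the quasi-triangle inequality `young_add_le`: `10 (1/20 + 1/20)
  -- = 1`.
  have e4 : ∀ᶠ n : ℕ in atTop, ∫⁻ x, ENNReal.ofReal (young ((1 - cutoff d n x) * (ε⁻¹ * ‖u x‖)))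
      ≤ ENNReal.ofReal (1 / 20) := by
    refine Tendsto.eventually_le_const (by positivity) (tendsto_lintegral_cutoff young_zero
      young_mono measurable_young (by fun_prop) (fun x => by positivity) ?_)
    exact lintegral_young_mul_lt_top (fun x => norm_nonneg _) hA (by positivity)
  obtain ⟨n, h1, h2, h3, h4⟩ := (e1.and (e2.and (e3.and e4))).exists
  set χ := cutoff d n with hχ
  have hχc : ContDiff ℝ ∞ χ := contDiff_cutoff d n
  have hχm : Measurable χ := hχc.continuous.measurable
  -- The cutoff is now frozen, so the truncated mollification error lives in a ball of finite
  -- measure, and making it small in `L²` makes its modular small. The mollification radius is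
  -- therefore chosen after `n`.
  obtain ⟨κ, hκ, hκy⟩ := exists_lintegral_young_le (F := ℂ) (μ := volume)
    (Metric.isClosed_closedBall (x := (0 : EuclideanSpace ℝ (Fin d)))
      (ε := 2 * (n + 1 : ℝ))).measurableSet measure_closedBall_lt_top hε
    (by norm_num : (0 : ℝ) < 1 / 20)
  -- `κ` serves the modular, `ε / 2` the `L²` distance, and `1` the bound `‖U‖ ≤ 1 + ‖u‖` used where
  -- the gradient falls on the cutoff.
  obtain ⟨δ₀, hδ₀, hδu⟩ := exists_convolution_sub_le u
    (ε := ENNReal.ofReal (min (min κ (ε / 2)) 1)) (by positivity)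
  choose δ hδ hδg using fun i => exists_convolution_sub_le (g i)
    (ε := ENNReal.ofReal (ε / 3)) (by positivity)
  obtain ⟨r, hr, hr0, hri⟩ : ∃ r : ℝ, 0 < r ∧ r ≤ δ₀ ∧ ∀ i, r ≤ δ i := by
    have : ∀ᶠ r in 𝓝[>] (0 : ℝ), 0 < r ∧ r ≤ δ₀ ∧ ∀ i, r ≤ δ i := by
      refine (eventually_mem_nhdsWithin (s := Set.Ioi (0 : ℝ))).and (nhdsWithin_le_nhds ?_)
      exact (eventually_le_nhds hδ₀).and (eventually_all.2 fun i => eventually_le_nhds (hδ i))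
    exact this.exists
  let f : ContDiffBump (0 : EuclideanSpace ℝ (Fin d)) := ⟨r / 2, r, by positivity, by linarith⟩
  replace hδu := hδu f hr0
  replace hδg := fun i => hδg i f (hri i)
  set U := f.normed volume ⋆[ContinuousLinearMap.lsmul ℝ ℝ, volume] u with hU
  have hUs : ContDiff ℝ ∞ U := contDiff_convolution_L2 f u
  have hUm : Measurable U := hUs.continuous.measurable
  have hGm : ∀ i, Measurable (f.normed volume ⋆[ContinuousLinearMap.lsmul ℝ ℝ, volume] g i) :=
    fun i => (contDiff_convolution_L2 f (g i)).continuous.measurable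
  have hχ01 : ∀ x, ‖χ x‖ ≤ 1 := fun x => by
    rw [Real.norm_of_nonneg (cutoff_nonneg n x)]; exact cutoff_le_one n x
  -- multiplication by the cutoff does not increase norms
  have hmul : ∀ F : EuclideanSpace ℝ (Fin d) → ℂ,
      eLpNorm (fun x => χ x • F x) 2 volume ≤ eLpNorm F 2 volume := fun F => by
    refine eLpNorm_mono fun x => ?_
    rw [norm_smul]
    exact mul_le_of_le_one_left (norm_nonneg _) (hχ01 x)
  have hdec : ∀ x, χ x • U x - u x = χ x • (U x - u x) - (1 - χ x) • u x := fun x => by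
    rw [smul_sub, sub_smul, one_smul]; ring
  have hEU : eLpNorm (fun x => χ x • (U x - u x)) 2 volume
      ≤ ENNReal.ofReal (min (min κ (ε / 2)) 1) := (hmul _).trans hδu
  refine ⟨fun x => χ x • U x, ⟨hχc.smul hUs, (hasCompactSupport_cutoff d n).smul_right⟩,
    ?_, fun i => ?_, ?_⟩
  · simp_rw [hdec]
    calc _ ≤ eLpNorm (fun x => χ x • (U x - u x)) 2 volume
          + eLpNorm (fun x => (1 - χ x) • u x) 2 volume :=
        eLpNorm_sub_le (by fun_prop) (by fun_prop) (by norm_num)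
      _ ≤ ENNReal.ofReal (ε / 2) + ENNReal.ofReal (ε / 2) := by
        gcongr
        exact hEU.trans (ENNReal.ofReal_le_ofReal ((min_le_left _ _).trans (min_le_right _ _)))
      _ = ENNReal.ofReal ε := by rw [← ENNReal.ofReal_add (by positivity) (by positivity)]; simp
  · have hd : ∀ x, partialDeriv (fun x => χ x • U x) i x - g i x
        = χ x • ((f.normed volume ⋆[ContinuousLinearMap.lsmul ℝ ℝ, volume] g i) x - g i x)
          - (1 - χ x) • g i x + (fderiv ℝ χ x (EuclideanSpace.single i 1)) • U x := by
      intro x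
      rw [partialDeriv, fderiv_fun_smul ((hχc.differentiable (by simp)) x)
        ((hUs.differentiable (by simp)) x)]
      simp only [_root_.add_apply, _root_.smul_apply,
        ContinuousLinearMap.smulRight_apply]
      rw [hU, fderiv_convolution_apply f hg i x, smul_sub, sub_smul, one_smul]
      ring
    have hfm : Measurable fun x => fderiv ℝ χ x (EuclideanSpace.single i 1) :=
      ((hχc.continuous_fderiv (by simp)).clm_apply continuous_const).measurable
    have hGi := hGm i
    have hgi := hgm i
    simp_rw [hd]
    have hUn : eLpNorm U 2 volume ≤ ENNReal.ofReal (1 + ‖u‖) := by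
      calc eLpNorm U 2 volume = eLpNorm (fun x => (U x - u x) + u x) 2 volume := by simp
        _ ≤ eLpNorm (fun x => U x - u x) 2 volume + eLpNorm u 2 volume :=
          eLpNorm_add_le (by fun_prop) (by fun_prop) (by norm_num)
        _ ≤ ENNReal.ofReal 1 + ENNReal.ofReal ‖u‖ := by
          gcongr
          · exact hδu.trans (ENNReal.ofReal_le_ofReal (min_le_right _ _))
          · rw [Lp.norm_def, ENNReal.ofReal_toReal (Lp.memLp u).2.ne]
        _ = _ := (ENNReal.ofReal_add zero_le_one (norm_nonneg _)).symm
    have hlast : eLpNorm (fun x => (fderiv ℝ χ x (EuclideanSpace.single i 1)) • U x) 2 volume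
        ≤ ENNReal.ofReal (ε / 3) := by
      calc _ ≤ ENNReal.ofReal (C / (n + 1)) * eLpNorm U 2 volume := by
            refine eLpNorm_le_mul_eLpNorm_of_ae_le_mul (Eventually.of_forall fun x => ?_) _
            rw [norm_smul]
            gcongr
            refine (ContinuousLinearMap.le_opNorm _ _).trans ?_
            rw [PiLp.norm_single, norm_one, mul_one]
            exact hCb n x
        _ ≤ ENNReal.ofReal (C / (n + 1)) * ENNReal.ofReal (1 + ‖u‖) := by gcongr
        _ ≤ _ := by
          rw [← ENNReal.ofReal_mul (by positivity)]
          exact ENNReal.ofReal_le_ofReal h3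
    calc _ ≤ eLpNorm (fun x => χ x • ((f.normed volume ⋆[ContinuousLinearMap.lsmul ℝ ℝ, volume]
              g i) x - g i x) - (1 - χ x) • g i x) 2 volume
          + eLpNorm (fun x => (fderiv ℝ χ x (EuclideanSpace.single i 1)) • U x) 2 volume :=
        eLpNorm_add_le (by fun_prop) (by fun_prop) (by norm_num)
      _ ≤ (eLpNorm (fun x => χ x • ((f.normed volume ⋆[ContinuousLinearMap.lsmul ℝ ℝ, volume]
              g i) x - g i x)) 2 volume + eLpNorm (fun x => (1 - χ x) • g i x) 2 volume)
          + ENNReal.ofReal (ε / 3) := by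
        gcongr
        exact eLpNorm_sub_le (by fun_prop) (by fun_prop) (by norm_num)
      _ ≤ (ENNReal.ofReal (ε / 3) + ENNReal.ofReal (ε / 3)) + ENNReal.ofReal (ε / 3) := by
        gcongr
        · exact (hmul _).trans (hδg i)
        · exact h2 i
      _ = ENNReal.ofReal ε := by
        rw [← ENNReal.ofReal_add (by positivity) (by positivity),
          ← ENNReal.ofReal_add (by positivity) (by positivity)]
        congr 1; ring
  · have hy1 := hκy (fun x => χ x • (U x - u x))
      (fun x hx => by simp only [hχ, cutoff_eq_zero hx, zero_smul])
      (hEU.trans (ENNReal.ofReal_le_ofReal ((min_le_left _ _).trans (min_le_left _ _))))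
    have hpt : ∀ x, ENNReal.ofReal (young (‖χ x • U x - u x‖ / ε))
        ≤ ENNReal.ofReal 10 * (ENNReal.ofReal (young (‖χ x • (U x - u x)‖ / ε))
          + ENNReal.ofReal (young ((1 - χ x) * (ε⁻¹ * ‖u x‖)))) := by
      intro x
      have hc1 : 0 ≤ 1 - χ x := by linarith [cutoff_le_one (d := d) n x]
      have hnn : 0 ≤ (1 - χ x) * (ε⁻¹ * ‖u x‖) := by positivity
      rw [← ENNReal.ofReal_add (young_nonneg (by positivity)) (young_nonneg hnn),
        ← ENNReal.ofReal_mul (by norm_num)]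
      refine ENNReal.ofReal_le_ofReal (le_trans (young_mono (by positivity) ?_)
        (young_add_le (by positivity) hnn))
      rw [hdec, div_le_iff₀ hε]
      refine (norm_sub_le _ _).trans_eq ?_
      rw [norm_smul (1 - χ x), Real.norm_of_nonneg hc1]
      field_simp
    have hym := measurable_young
    calc _ ≤ _ := lintegral_mono hpt
      _ ≤ ENNReal.ofReal 10 * (ENNReal.ofReal (1 / 20) + ENNReal.ofReal (1 / 20)) := by
        rw [lintegral_const_mul' _ _ ENNReal.ofReal_ne_top, lintegral_add_left (by fun_prop)]
        gcongr
      _ = 1 := by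
        rw [← ENNReal.ofReal_add (by positivity) (by positivity), ← ENNReal.ofReal_mul (by norm_num)]
        norm_num

/-! ### A Sobolev embedding -/

theorem enorm_le_lintegral_fderiv_of_dim_one {w : EuclideanSpace ℝ (Fin 1) → ℝ}
    (hw : ContDiff ℝ 1 w) (hc : HasCompactSupport w) (x : EuclideanSpace ℝ (Fin 1)) :
    ‖w x‖ₑ ≤ ∫⁻ y, ‖fderiv ℝ w y‖ₑ := by
  let ℓ : ℝ ≃ₗᵢ[ℝ] EuclideanSpace ℝ (Fin 1) := (OrthonormalBasis.singleton (Fin 1) ℝ).repr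
  have hℓ : MeasurePreserving ℓ volume volume := ℓ.measurePreserving
  have h1 := HasCompactSupport.enorm_le_lintegral_Ici_deriv (f := w ∘ ℓ)
    (hw.comp ℓ.contDiff) (hc.comp_homeomorph ℓ.toHomeomorph) (ℓ.symm x)
  have hd : ∀ t, ‖deriv (w ∘ ℓ) t‖ₑ ≤ ‖fderiv ℝ w (ℓ t)‖ₑ := by
    intro t
    have h2 : HasDerivAt (w ∘ ℓ) (fderiv ℝ w (ℓ t) (ℓ 1)) t := by
      have h3 : HasDerivAt ℓ (ℓ 1) t := by
        have := (ℓ.toContinuousLinearEquiv : ℝ →L[ℝ] EuclideanSpace ℝ (Fin 1)).hasDerivAt (x := t)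
        exact this
      exact ((hw.differentiable (by simp)) (ℓ t)).hasFDerivAt.comp_hasDerivAt t h3
    rw [h2.deriv, enorm_le_iff_norm_le]
    refine (ContinuousLinearMap.le_opNorm _ _).trans ?_
    rw [ℓ.norm_map, norm_one, mul_one]
  have hm : Measurable fun y => ‖fderiv ℝ w y‖ₑ :=
    (hw.continuous_fderiv (by simp)).measurable.enorm
  calc ‖w x‖ₑ = ‖(w ∘ ℓ) (ℓ.symm x)‖ₑ := by simp
    _ ≤ _ := h1
    _ ≤ ∫⁻ t, ‖fderiv ℝ w (ℓ t)‖ₑ := (setLIntegral_le_lintegral _ _).trans (lintegral_mono hd)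
    _ = _ := hℓ.lintegral_comp hm

/-- For `d ≥ 2` this is Gagliardo–Nirenberg with `q = d/(d-1)`. For `d = 1` that exponent is
infinite, and `q = 2` follows from `∫ |w|² ≤ sup |w| ∫ |w|` with the supremum bounded by `∫ |w'|`.
It is meant for `w = |φ|²`, where it bounds the `L^{2q}` norm of `φ` by its `H¹` norm. -/
theorem exists_gagliardo_nirenberg {d : ℕ} (hd : 1 ≤ d) :
    ∃ q : ℝ, 1 < q ∧ ∃ C : ℝ≥0∞, C ≠ ⊤ ∧ ∀ w : EuclideanSpace ℝ (Fin d) → ℝ, ContDiff ℝ 1 w →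
      HasCompactSupport w → ∫⁻ x, ‖w x‖ₑ ^ q ≤
        C * ((∫⁻ x, ‖w x‖ₑ) + ∫⁻ x, ‖fderiv ℝ w x‖ₑ) ^ q := by
  rcases hd.eq_or_lt with rfl | hd
  · refine ⟨2, one_lt_two, 1, ENNReal.one_ne_top, fun w hw hc => ?_⟩
    have hm : Measurable w := hw.continuous.measurable
    rw [one_mul, ENNReal.rpow_two, sq]
    calc _ ≤ ∫⁻ x, (∫⁻ y, ‖fderiv ℝ w y‖ₑ) * ‖w x‖ₑ := by
          refine lintegral_mono fun x => ?_
          change _ ^ (2 : ℝ) ≤ _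
          rw [ENNReal.rpow_two, sq]
          gcongr
          exact enorm_le_lintegral_fderiv_of_dim_one hw hc x
      _ = (∫⁻ y, ‖fderiv ℝ w y‖ₑ) * ∫⁻ x, ‖w x‖ₑ := lintegral_const_mul _ (by fun_prop)
      _ ≤ _ := by
        gcongr
        · exact le_add_self
        · exact le_self_add
  · have hp : Real.HolderConjugate (Module.finrank ℝ (EuclideanSpace ℝ (Fin d)))
        (Real.conjExponent d) := by
      rw [finrank_euclideanSpace_fin]
      exact Real.HolderConjugate.conjExponent (by exact_mod_cast hd)
    refine ⟨_, hp.symm.lt, lintegralPowLePowLIntegralFDerivConst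
      (volume : Measure (EuclideanSpace ℝ (Fin d))) (Real.conjExponent d),
      ENNReal.coe_ne_top, fun w hw hc => ?_⟩
    refine (lintegral_pow_le_pow_lintegral_fderiv volume hw hc hp).trans ?_
    gcongr
    · exact hp.symm.nonneg
    · exact le_add_self

theorem norm_sq_le_card_mul_sum {d : ℕ} (L : EuclideanSpace ℝ (Fin d) →L[ℝ] ℂ) :
    ‖L‖ ^ 2 ≤ d * ∑ i, ‖L (EuclideanSpace.single i 1)‖ ^ 2 := by
  have h : ‖L‖ ≤ ∑ i, ‖L (EuclideanSpace.single i 1)‖ := by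
    refine L.opNorm_le_bound (by positivity) fun v => ?_
    have hv : L v = ∑ i, v i • L (EuclideanSpace.single i 1) := by
      have := (EuclideanSpace.basisFun (Fin d) ℝ).sum_repr v
      conv_lhs => rw [← this]
      simp
    rw [hv, Finset.sum_mul]
    refine (norm_sum_le _ _).trans (Finset.sum_le_sum fun i _ => ?_)
    rw [norm_smul, mul_comm]
    gcongr
    exact PiLp.norm_apply_le v i
  calc ‖L‖ ^ 2 ≤ (∑ i, ‖L (EuclideanSpace.single i 1)‖) ^ 2 := by gcongr
    _ ≤ _ := by
      simpa using sq_sum_le_card_mul_sum_sq (s := Finset.univ)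
        (f := fun i => ‖L (EuclideanSpace.single i 1)‖)

/-- The gradient of `|φ|²` has norm at most `2 |φ| |∇φ| ≤ |φ|² + |∇φ|²`. -/
theorem lintegral_fderiv_norm_sq_le {d : ℕ} {φ : EuclideanSpace ℝ (Fin d) → ℂ}
    (hφ : IsTestFunction φ) :
    ∫⁻ x, ‖fderiv ℝ (fun x => ‖φ x‖ ^ 2) x‖ₑ
      ≤ eLpNorm φ 2 volume ^ 2 + d * ∑ i, eLpNorm (partialDeriv φ i) 2 volume ^ 2 := by
  have hpt : ∀ x, ‖fderiv ℝ (fun x => ‖φ x‖ ^ 2) x‖ₑ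
      ≤ ‖φ x‖ₑ ^ 2 + d * ∑ i, ‖partialDeriv φ i x‖ₑ ^ 2 := by
    intro x
    have h1 := ((hφ.contDiff.differentiable (by simp)) x).hasFDerivAt.norm_sq
    have h2 : ‖fderiv ℝ (fun x => ‖φ x‖ ^ 2) x‖ ≤ 2 * (‖φ x‖ * ‖fderiv ℝ φ x‖) := by
      have h3 : fderiv ℝ (fun x => ‖φ x‖ ^ 2) x = _ := h1.fderiv
      rw [h3, ← Nat.cast_smul_eq_nsmul ℝ, norm_smul]
      refine mul_le_mul (by simp) ((ContinuousLinearMap.opNorm_comp_le _ _).trans ?_)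
        (norm_nonneg _) (by norm_num)
      rw [innerSL_apply_norm]
    have h4 : ‖fderiv ℝ (fun x => ‖φ x‖ ^ 2) x‖
        ≤ ‖φ x‖ ^ 2 + d * ∑ i, ‖partialDeriv φ i x‖ ^ 2 := by
      have := norm_sq_le_card_mul_sum (fderiv ℝ φ x)
      change _ ≤ d * ∑ i, ‖partialDeriv φ i x‖ ^ 2 at this
      nlinarith [sq_nonneg (‖φ x‖ - ‖fderiv ℝ φ x‖)]
    have h5 : ∀ i, ‖partialDeriv φ i x‖ₑ ^ 2 = ENNReal.ofReal (‖partialDeriv φ i x‖ ^ 2) :=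
      fun i => by rw [ENNReal.ofReal_pow (norm_nonneg _), ofReal_norm]
    simp_rw [h5]
    rw [← ENNReal.ofReal_sum_of_nonneg (fun i _ => by positivity), ← ofReal_norm (φ x),
      ← ENNReal.ofReal_pow (norm_nonneg _), ← ENNReal.ofReal_natCast,
      ← ENNReal.ofReal_mul (by positivity), ← ENNReal.ofReal_add (by positivity) (by positivity),
      ← ofReal_norm]
    exact ENNReal.ofReal_le_ofReal h4
  have hm := hφ.continuous.measurable
  have hmi := fun i => (hφ.partialDeriv i).continuous.measurable
  refine (lintegral_mono hpt).trans_eq ?_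
  rw [lintegral_add_left (by fun_prop), lintegral_const_mul _ (by fun_prop),
    lintegral_finsetSum _ (by fun_prop)]
  simp_rw [eLpNorm_two_sq]

/-- A Sobolev embedding into some `L^{2q}` with `q > 1`. -/
theorem exists_sobolev_exponent {d : ℕ} (hd : 1 ≤ d) : ∃ q : ℝ, 1 < q ∧ ∀ M : ℝ,
    ∃ C : ℝ≥0∞, C ≠ ⊤ ∧ ∀ (u : L2 d) (g : Fin d → L2 d), IsWeakGradient u g →
      ∫⁻ x, ENNReal.ofReal (young ‖u x‖) < ⊤ → ‖u‖ ≤ M → (∀ i, ‖g i‖ ≤ M) →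
      ∫⁻ x, ENNReal.ofReal (‖u x‖ ^ (2 * q)) ≤ C := by
  obtain ⟨q, hq, C, hC, h⟩ := exists_gagliardo_nirenberg hd
  have hq0 : 0 < q := one_pos.trans hq
  refine ⟨q, hq, fun M => ?_⟩
  set K : ℝ≥0∞ := ENNReal.ofReal (M + 1) ^ 2 with hK
  refine ⟨C * (K + (K + d * (d * K))) ^ q, ?_, fun u g hg hA hu hgM => ?_⟩
  · have hKt : K ≠ ⊤ := ENNReal.pow_ne_top ENNReal.ofReal_ne_top
    have : K + (K + d * (d * K)) ≠ ⊤ := by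
      simp [ENNReal.mul_eq_top, hKt]
    exact ENNReal.mul_ne_top hC (ENNReal.rpow_ne_top_of_nonneg hq0.le this)
  have hM : 0 ≤ M := (norm_nonneg u).trans hu
  choose φ hφ hφu hφg _ using fun n : ℕ => exists_testFunction_near hg hA
    (ε := 1 / (n + 1 : ℝ)) (by positivity)
  have hum : Measurable u := (Lp.stronglyMeasurable u).measurable
  have hle1 : ∀ n : ℕ, ENNReal.ofReal (1 / (n + 1 : ℝ)) ≤ ENNReal.ofReal 1 := fun n =>
    ENNReal.ofReal_le_ofReal ((div_le_one (by positivity)).2 (by linarith [Nat.cast_nonneg (α := ℝ) n]))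
  have hnorm : ∀ (ψ : EuclideanSpace ℝ (Fin d) → ℂ) (v : L2 d), Continuous ψ → ‖v‖ ≤ M →
      eLpNorm (fun x => ψ x - v x) 2 volume ≤ ENNReal.ofReal 1 → eLpNorm ψ 2 volume ^ 2 ≤ K := by
    intro ψ v hψ hv hψv
    have hvm : Measurable v := (Lp.stronglyMeasurable v).measurable
    have hψm := hψ.measurable
    rw [hK]
    gcongr
    calc eLpNorm ψ 2 volume = eLpNorm (fun x => (ψ x - v x) + v x) 2 volume := by simp
      _ ≤ eLpNorm (fun x => ψ x - v x) 2 volume + eLpNorm v 2 volume :=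
        eLpNorm_add_le (by fun_prop) (by fun_prop) (by norm_num)
      _ ≤ ENNReal.ofReal 1 + ENNReal.ofReal M := by
        gcongr
        rw [← ENNReal.ofReal_toReal (Lp.memLp v).2.ne, ← Lp.norm_def]
        exact ENNReal.ofReal_le_ofReal hv
      _ = _ := by rw [← ENNReal.ofReal_add zero_le_one hM, add_comm]
  have hbound : ∀ n, ∫⁻ x, ENNReal.ofReal (‖φ n x‖ ^ (2 * q)) ≤ C * (K + (K + d * (d * K))) ^ q := by
    intro n
    have h1 := h (fun x => ‖φ n x‖ ^ 2) (((hφ n).contDiff.norm_sq ℝ).of_le (by simp))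
      ((hφ n).hasCompactSupport.comp_left (g := fun z : ℂ => ‖z‖ ^ 2) (by simp))
    have h2 : ∀ x, ‖‖φ n x‖ ^ 2‖ₑ = ‖φ n x‖ₑ ^ 2 := fun x => by
      rw [Real.enorm_of_nonneg (by positivity), ENNReal.ofReal_pow (norm_nonneg _), ofReal_norm]
    have h3 : ∀ x, ENNReal.ofReal (‖φ n x‖ ^ (2 * q)) = ‖‖φ n x‖ ^ 2‖ₑ ^ q := fun x => by
      rw [h2, ← ENNReal.rpow_two, ← ENNReal.rpow_mul, ← ofReal_norm,
        ENNReal.ofReal_rpow_of_nonneg (norm_nonneg _) (by positivity)]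
    simp_rw [h3]
    refine h1.trans ?_
    have h4 : ∫⁻ x, ‖‖φ n x‖ ^ 2‖ₑ ≤ K := by
      simp_rw [h2]
      rw [← eLpNorm_two_sq]
      exact hnorm _ u (hφ n).continuous hu ((hφu n).trans (hle1 n))
    have h5 : ∫⁻ x, ‖fderiv ℝ (fun x => ‖φ n x‖ ^ 2) x‖ₑ ≤ K + d * (d * K) := by
      refine (lintegral_fderiv_norm_sq_le (hφ n)).trans ?_
      gcongr
      · exact hnorm _ u (hφ n).continuous hu ((hφu n).trans (hle1 n))
      · calc _ ≤ ∑ _i : Fin d, K := Finset.sum_le_sum fun i _ =>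
              hnorm _ (g i) ((hφ n).partialDeriv i).continuous (hgM i) ((hφg n i).trans (hle1 n))
          _ = _ := by simp
    gcongr
  -- The bound passes from the approximants to `u` by Fatou along an almost everywhere convergent
  -- subsequence.
  have htm : TendstoInMeasure volume φ atTop u := by
    refine tendstoInMeasure_of_tendsto_eLpNorm (p := 2) (by norm_num)
      (fun n => (hφ n).continuous.aestronglyMeasurable) hum.aestronglyMeasurable ?_
    refine tendsto_of_tendsto_of_tendsto_of_le_of_le tendsto_const_nhds
      ?_ (fun _ => zero_le) hφu
    have := ENNReal.tendsto_ofReal tendsto_one_div_add_atTop_nhds_zero_nat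
    simpa using this
  obtain ⟨ns, -, hae⟩ := htm.exists_seq_tendsto_ae
  calc ∫⁻ x, ENNReal.ofReal (‖u x‖ ^ (2 * q))
      = ∫⁻ x, liminf (fun k => ENNReal.ofReal (‖φ (ns k) x‖ ^ (2 * q))) atTop := by
        refine lintegral_congr_ae ?_
        filter_upwards [hae] with x hx
        refine (Tendsto.liminf_eq ?_).symm
        exact ENNReal.tendsto_ofReal (hx.norm.rpow_const (Or.inr (by positivity)))
    _ ≤ liminf (fun k => ∫⁻ x, ENNReal.ofReal (‖φ (ns k) x‖ ^ (2 * q))) atTop := by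
        refine lintegral_liminf_le fun k => ?_
        have := (hφ (ns k)).continuous.measurable
        fun_prop
    _ ≤ _ := by
        refine liminf_le_of_le (by isBoundedDefault) fun b hb => ?_
        obtain ⟨k, hk⟩ := hb.exists
        exact hk.trans (hbound _)

/-! ### Pairing with the nonlinearity -/

/-- `C` is an admissible constant in the Young type inequality of exponent `q`. -/
def IsPairingConst (q C : ℝ) : Prop := ∀ s r : ℝ, 0 ≤ s → 0 ≤ r →
  |s * Real.log (s ^ 2)| * r ≤ C * (young s + s ^ (2 * q)) + (2 * young r + r ^ 2)

/-- The modular that controls the nonlinearity. -/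
def logModular {d : ℕ} (q : ℝ) (u : EuclideanSpace ℝ (Fin d) → ℂ) : ℝ≥0∞ :=
  ∫⁻ x, ENNReal.ofReal (young ‖u x‖ + ‖u x‖ ^ (2 * q))

/-- `ψ` has norm at most `ε` in `L²` and in the Orlicz space of `young`. -/
structure IsSmall {d : ℕ} (ψ : EuclideanSpace ℝ (Fin d) → ℂ) (ε : ℝ) : Prop where
  eLpNorm_le : eLpNorm ψ 2 volume ≤ ENNReal.ofReal ε
  young_le : ∫⁻ x, ENNReal.ofReal (young (‖ψ x‖ / ε)) ≤ 1

theorem IsSmall.congr {d : ℕ} {ψ χ : EuclideanSpace ℝ (Fin d) → ℂ} {ε : ℝ} (h : IsSmall ψ ε)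
    (hχ : ψ =ᵐ[volume] χ) : IsSmall χ ε where
  eLpNorm_le := (eLpNorm_congr_ae hχ).symm.trans_le h.eLpNorm_le
  young_le := by
    refine le_of_eq_of_le (lintegral_congr_ae ?_) h.young_le
    filter_upwards [hχ] with x hx
    rw [hx]

theorem IsSmall.mono {d : ℕ} {ψ : EuclideanSpace ℝ (Fin d) → ℂ} {ε ε' : ℝ} (h : IsSmall ψ ε)
    (hε : 0 < ε) (hεε' : ε ≤ ε') : IsSmall ψ ε' where
  eLpNorm_le := h.eLpNorm_le.trans (ENNReal.ofReal_le_ofReal hεε')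
  young_le := by
    refine (lintegral_mono fun x => ENNReal.ofReal_le_ofReal (young_mono ?_ ?_)).trans h.young_le
    · have := hε.trans_le hεε'
      positivity
    · gcongr

/-- The Young type inequality is applied to `ψ / ε` and multiplied by `ε`. This makes the pairing of
order `ε` for `ψ` of size `ε`, although the modular is not homogeneous. -/
theorem lintegral_pairing_le {d : ℕ} {q C : ℝ} (hq : IsPairingConst q C) (hC : 0 ≤ C)
    {u ψ : EuclideanSpace ℝ (Fin d) → ℂ} (hu : AEMeasurable u) (hψ : AEMeasurable ψ)
    {ε : ℝ} (hε : 0 < ε) :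
    ∫⁻ x, ‖logNonlinearity (u x)‖ₑ * ‖ψ x‖ₑ ≤ ENNReal.ofReal ε * (ENNReal.ofReal C * logModular q u
      + (2 * (∫⁻ x, ENNReal.ofReal (young (‖ψ x‖ / ε)))
        + (ENNReal.ofReal ε⁻¹) ^ 2 * eLpNorm ψ 2 volume ^ 2)) := by
  have hpt : ∀ x, ‖logNonlinearity (u x)‖ₑ * ‖ψ x‖ₑ ≤ ENNReal.ofReal ε *
      (ENNReal.ofReal C * ENNReal.ofReal (young ‖u x‖ + ‖u x‖ ^ (2 * q))
      + (2 * ENNReal.ofReal (young (‖ψ x‖ / ε)) + ENNReal.ofReal ε⁻¹ ^ 2 * ‖ψ x‖ₑ ^ 2)) := by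
    intro x
    have h1 := hq ‖u x‖ (‖ψ x‖ / ε) (norm_nonneg _) (by positivity)
    have hy1 := young_nonneg (norm_nonneg (u x))
    have hy2 := young_nonneg (by positivity : 0 ≤ ‖ψ x‖ / ε)
    have h2 : (2 : ℝ≥0∞) = ENNReal.ofReal 2 := by simp
    rw [h2, ← ofReal_norm, ← ofReal_norm, ← ENNReal.ofReal_mul (norm_nonneg _),
      ← ENNReal.ofReal_pow (by positivity), ← ENNReal.ofReal_pow (by positivity),
      ← ENNReal.ofReal_mul hC, ← ENNReal.ofReal_mul (by positivity),
      ← ENNReal.ofReal_mul (by positivity), ← ENNReal.ofReal_add (by positivity) (by positivity),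
      ← ENNReal.ofReal_add (by positivity) (by positivity), ← ENNReal.ofReal_mul hε.le]
    apply ENNReal.ofReal_le_ofReal
    rw [norm_logNonlinearity]
    calc _ = ε * (|‖u x‖ * Real.log (‖u x‖ ^ 2)| * (‖ψ x‖ / ε)) := by field_simp
      _ ≤ _ := mul_le_mul_of_nonneg_left h1 hε.le
      _ = _ := by rw [div_pow, inv_pow]; ring
  have hym := measurable_young
  refine (lintegral_mono hpt).trans_eq ?_
  rw [lintegral_const_mul' _ _ ENNReal.ofReal_ne_top, lintegral_add_left' (by fun_prop),
    lintegral_const_mul' _ _ ENNReal.ofReal_ne_top, lintegral_add_left' (by fun_prop),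
    lintegral_const_mul' _ _ ENNReal.ofNat_ne_top,
    lintegral_const_mul' _ _ (ENNReal.pow_ne_top ENNReal.ofReal_ne_top), eLpNorm_two_sq, logModular]

theorem IsSmall.lintegral_pairing_le {d : ℕ} {q C : ℝ} (hq : IsPairingConst q C) (hC : 0 ≤ C)
    {u ψ : EuclideanSpace ℝ (Fin d) → ℂ} (hu : AEMeasurable u) (hψ : AEMeasurable ψ)
    {ε : ℝ} (hε : 0 < ε) (h : IsSmall ψ ε) {K : ℝ} (hK : 0 ≤ K)
    (huK : logModular q u ≤ ENNReal.ofReal K) :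
    ∫⁻ x, ‖logNonlinearity (u x)‖ₑ * ‖ψ x‖ₑ ≤ ENNReal.ofReal (ε * (C * K + 3)) := by
  refine (LogNLS.lintegral_pairing_le hq hC hu hψ hε).trans ?_
  calc _ ≤ ENNReal.ofReal ε * (ENNReal.ofReal C * ENNReal.ofReal K
      + (2 * 1 + (ENNReal.ofReal ε⁻¹) ^ 2 * ENNReal.ofReal ε ^ 2)) := by
        gcongr
        · exact h.young_le
        · exact h.eLpNorm_le
    _ = _ := by
      rw [← mul_pow, ← ENNReal.ofReal_mul (inv_nonneg.2 hε.le), inv_mul_cancel₀ hε.ne',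
        ENNReal.ofReal_one, ENNReal.ofReal_mul hε.le, ENNReal.ofReal_add (by positivity) (by norm_num),
        ENNReal.ofReal_mul hC]
      norm_num

theorem IsTestFunction.lintegral_young_lt_top {d : ℕ} {φ : EuclideanSpace ℝ (Fin d) → ℂ}
    (hφ : IsTestFunction φ) : ∫⁻ x, ENNReal.ofReal (young ‖φ x‖) < ⊤ := by
  have h1 : Integrable (fun x => 2 * ‖φ x‖ + 7 * ‖φ x‖ ^ 2) :=
    ((hφ.continuous.integrable_of_hasCompactSupport hφ.hasCompactSupport).norm.const_mul 2).add
      (hφ.memLp.norm.integrable_sq.const_mul 7)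
  refine (lintegral_mono fun x => ENNReal.ofReal_le_ofReal ?_).trans_lt
    (Integrable.lintegral_lt_top h1)
  exact young_le_add_sq (norm_nonneg _)

theorem IsTestFunction.integrable_pairing {d : ℕ} {q C : ℝ} (hq : IsPairingConst q C) (hC : 0 ≤ C)
    {φ : EuclideanSpace ℝ (Fin d) → ℂ} (hφ : IsTestFunction φ) (u : L2 d)
    (hu : logModular q u < ⊤) :
    Integrable (fun x => logNonlinearity (u x) * (starRingEnd ℂ) (φ x)) := by
  have hum : Measurable u := (Lp.stronglyMeasurable u).measurable
  have hlm := measurable_logNonlinearity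
  have hφm := hφ.continuous.measurable
  refine ⟨Measurable.aestronglyMeasurable ?_, ?_⟩
  · have : Measurable (starRingEnd ℂ) := Complex.continuous_conj.measurable
    fun_prop
  · rw [HasFiniteIntegral]
    simp_rw [enorm_mul, RCLike.enorm_conj]
    refine (lintegral_pairing_le hq hC hum.aemeasurable hφm.aemeasurable one_pos).trans_lt ?_
    have h1 := hφ.lintegral_young_lt_top
    have h2 : eLpNorm φ 2 volume < ⊤ := hφ.memLp.2
    simp only [div_one, inv_one, ENNReal.ofReal_one, one_mul, one_pow]
    exact ENNReal.add_lt_top.2 ⟨ENNReal.mul_lt_top ENNReal.ofReal_lt_top hu,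
      ENNReal.add_lt_top.2 ⟨ENNReal.mul_lt_top (by simp) h1, ENNReal.pow_lt_top h2⟩⟩

/-! ### Weak gradients and the tested equation -/

theorem integrable_L2_mul_testFunction {d : ℕ} (u : L2 d) {φ : EuclideanSpace ℝ (Fin d) → ℂ}
    (hφ : IsTestFunction φ) : Integrable (fun x => u x * φ x) :=
  MemLp.integrable_mul (p := 2) (q := 2) (Lp.memLp u) hφ.memLp

theorem IsWeakGradient.add {d : ℕ} {u v : L2 d} {g h : Fin d → L2 d} (hu : IsWeakGradient u g)
    (hv : IsWeakGradient v h) : IsWeakGradient (u + v) (g + h) := by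
  intro φ hφ i
  have e1 : ∀ (a b : L2 d) {χ : EuclideanSpace ℝ (Fin d) → ℂ}, IsTestFunction χ →
      ∫ x, (a + b : L2 d) x * χ x = (∫ x, a x * χ x) + ∫ x, b x * χ x := by
    intro a b χ hχ
    rw [← integral_add (integrable_L2_mul_testFunction a hχ) (integrable_L2_mul_testFunction b hχ)]
    refine integral_congr_ae ?_
    filter_upwards [Lp.coeFn_add a b] with x hx
    rw [hx, Pi.add_apply, add_mul]
  have h1 := hu φ hφ i
  have h2 := hv φ hφ i
  have h3 := e1 u v (hφ.partialDeriv i)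
  simp only [LogNLS.partialDeriv] at h3
  rw [h3, h1, h2, Pi.add_apply, e1 _ _ hφ]
  ring

theorem IsWeakGradient.neg {d : ℕ} {u : L2 d} {g : Fin d → L2 d} (hu : IsWeakGradient u g) :
    IsWeakGradient (-u) (-g) := by
  intro φ hφ i
  have e1 : ∀ (a : L2 d) (χ : EuclideanSpace ℝ (Fin d) → ℂ),
      ∫ x, (-a : L2 d) x * χ x = - ∫ x, a x * χ x := by
    intro a χ
    rw [← integral_neg]
    refine integral_congr_ae ?_
    filter_upwards [Lp.coeFn_neg a] with x hx
    rw [hx, Pi.neg_apply, neg_mul]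
  rw [e1 u (fun x => fderiv ℝ φ x (EuclideanSpace.single i 1)), hu φ hφ i, Pi.neg_apply, e1]

theorem IsWeakGradient.sub {d : ℕ} {u v : L2 d} {g h : Fin d → L2 d} (hu : IsWeakGradient u g)
    (hv : IsWeakGradient v h) : IsWeakGradient (u - v) (g - h) := by
  rw [sub_eq_add_neg, sub_eq_add_neg]
  exact hu.add hv.neg

theorem laplacian_eq_sum_partialDeriv {d : ℕ} {φ : EuclideanSpace ℝ (Fin d) → ℂ}
    (hφ : IsTestFunction φ) (x : EuclideanSpace ℝ (Fin d)) :
    Δ φ x = ∑ i, partialDeriv (partialDeriv φ i) i x := by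
  rw [InnerProductSpace.laplacian_eq_iteratedFDeriv_orthonormalBasis φ
    (EuclideanSpace.basisFun (Fin d) ℝ)]
  refine Finset.sum_congr rfl fun i _ => ?_
  rw [iteratedFDeriv_two_apply]
  have h1 : DifferentiableAt ℝ (fderiv ℝ φ) x :=
    ((hφ.contDiff.fderiv_right (m := ∞) (by simp)).differentiable (by simp)) x
  have h2 : partialDeriv φ i = fun y => fderiv ℝ φ y (EuclideanSpace.single i 1) := rfl
  rw [h2, partialDeriv, fderiv_clm_apply h1 (by fun_prop)]
  simp

theorem IsWeakGradient.integral_laplacian {d : ℕ} {u : L2 d} {g : Fin d → L2 d}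
    (hg : IsWeakGradient u g) {φ : EuclideanSpace ℝ (Fin d) → ℂ} (hφ : IsTestFunction φ) :
    ∫ x, u x * Δ φ x = -∑ i, ∫ x, g i x * partialDeriv φ i x := by
  simp_rw [laplacian_eq_sum_partialDeriv hφ, Finset.mul_sum]
  rw [integral_finsetSum _ fun i _ =>
    integrable_L2_mul_testFunction u ((hφ.partialDeriv i).partialDeriv i), ← Finset.sum_neg_distrib]
  exact Finset.sum_congr rfl fun i _ => hg _ (hφ.partialDeriv i) i

theorem IsTestFunction.conj {d : ℕ} {φ : EuclideanSpace ℝ (Fin d) → ℂ} (hφ : IsTestFunction φ) :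
    IsTestFunction (fun x => (starRingEnd ℂ) (φ x)) where
  contDiff := Complex.conjCLE.contDiff.comp hφ.contDiff
  hasCompactSupport := hφ.hasCompactSupport.comp_left (map_zero _)

theorem IsTestFunction.partialDeriv_conj {d : ℕ} {φ : EuclideanSpace ℝ (Fin d) → ℂ}
    (hφ : IsTestFunction φ) (i : Fin d) (x : EuclideanSpace ℝ (Fin d)) :
    LogNLS.partialDeriv (fun x => (starRingEnd ℂ) (φ x)) i x
      = (starRingEnd ℂ) (LogNLS.partialDeriv φ i x) := by
  have h : HasFDerivAt (fun x => (starRingEnd ℂ) (φ x)) _ x :=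
    (Complex.conjCLE : ℂ →L[ℝ] ℂ).hasFDerivAt.comp x
      ((hφ.contDiff.differentiable (by simp)) x).hasFDerivAt
  rw [LogNLS.partialDeriv, h.fderiv]
  rfl

/-- A test function as an element of `L²`. -/
def IsTestFunction.toL2 {d : ℕ} {φ : EuclideanSpace ℝ (Fin d) → ℂ} (hφ : IsTestFunction φ) :
    L2 d := hφ.memLp.toLp φ

theorem IsTestFunction.coeFn_toL2 {d : ℕ} {φ : EuclideanSpace ℝ (Fin d) → ℂ}
    (hφ : IsTestFunction φ) : hφ.toL2 =ᵐ[volume] φ := MemLp.coeFn_toLp _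

theorem IsTestFunction.inner_toL2 {d : ℕ} {φ : EuclideanSpace ℝ (Fin d) → ℂ}
    (hφ : IsTestFunction φ) (u : L2 d) :
    inner ℂ hφ.toL2 u = ∫ x, u x * (starRingEnd ℂ) (φ x) := by
  rw [L2.inner_def]
  refine integral_congr_ae ?_
  filter_upwards [hφ.coeFn_toL2] with x hx
  rw [hx, RCLike.inner_apply]

/-- The equation, tested against the conjugate of a test function, in the form that uses only
weak gradients. -/
theorem IsSolution.hasDerivAt_inner {d : ℕ} {lam : ℝ} {v : ℝ → L2 d} (hv : IsSolution lam v)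
    {φ : EuclideanSpace ℝ (Fin d) → ℂ} (hφ : IsTestFunction φ) {τ : ℝ} {g : Fin d → L2 d}
    (hg : IsWeakGradient (v τ) g) :
    HasDerivAt (fun r => inner ℂ hφ.toL2 (v r))
      (Complex.I * ((1 / 2) * (-∑ i, inner ℂ (hφ.partialDeriv i).toL2 (g i))
        + lam * ∫ x, logNonlinearity (v τ x) * (starRingEnd ℂ) (φ x))) τ := by
  have h := hv.equation _ hφ.conj τ
  rw [hg.integral_laplacian hφ.conj] at h
  simp_rw [hφ.partialDeriv_conj] at h
  simp_rw [IsTestFunction.inner_toL2]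
  exact h

/-! ### Bounds uniform for nearby times -/

/-- Strict smallness of the energy norm turns its two infima into witnesses: a weak gradient and a
Luxemburg constant below `ε`. -/
theorem IsSolution.eventually_close {d : ℕ} {lam : ℝ} {v : ℝ → L2 d} (hv : IsSolution lam v)
    (s : ℝ) {ε : ℝ} (hε : 0 < ε) :
    ∀ᶠ t in 𝓝 s, ∃ g : Fin d → L2 d, IsWeakGradient (v t - v s) g ∧ (∀ i, ‖g i‖ ≤ ε) ∧
      IsSmall (v t - v s : L2 d) ε ∧ ‖v t - v s‖ ≤ ε := by
  have hev := (hv.continuous_energyNorm s).eventually_lt_const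
    (ENNReal.ofReal_pos.2 hε)
  filter_upwards [hev] with t ht
  have h1 : h1Norm (v t - v s) < ENNReal.ofReal ε := lt_of_le_of_lt le_self_add ht
  have h2 : luxemburgNorm (v t - v s) < ENNReal.ofReal ε := lt_of_le_of_lt le_add_self ht
  simp only [h1Norm, iInf_lt_iff] at h1
  simp only [luxemburgNorm, iInf_lt_iff] at h2
  obtain ⟨g, hg, h1⟩ := h1
  obtain ⟨k, hk, hy, h2⟩ := h2
  rw [ENNReal.ofReal_lt_ofReal_iff hε] at h1 h2
  have hsum : 0 ≤ ∑ i, ‖g i‖ ^ 2 := Finset.sum_nonneg fun i _ => by positivity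
  have hnorm : ‖v t - v s‖ ≤ ε := by
    refine le_trans (Real.le_sqrt_of_sq_le ?_) h1.le
    linarith
  refine ⟨g, hg, fun i => ?_, ⟨?_, ?_⟩, hnorm⟩
  · refine le_trans (Real.le_sqrt_of_sq_le ?_) h1.le
    have := Finset.single_le_sum (f := fun i => ‖g i‖ ^ 2) (fun i _ => by positivity)
      (Finset.mem_univ i)
    have h3 : 0 ≤ ‖v t - v s‖ ^ 2 := by positivity
    linarith
  · rw [← ENNReal.ofReal_toReal (Lp.memLp (v t - v s)).2.ne, ← Lp.norm_def]
    exact ENNReal.ofReal_le_ofReal hnorm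
  · refine (lintegral_mono fun x => ENNReal.ofReal_le_ofReal (young_mono ?_ ?_)).trans hy
    · positivity
    · gcongr

theorem lintegral_young_lt_top_of_mem_energySpace {d : ℕ} {u : L2 d} (hu : u ∈ energySpace d) :
    ∫⁻ x, ENNReal.ofReal (young ‖u x‖) < ⊤ := by
  have h1 : Integrable (fun x => |‖u x‖ ^ 2 * Real.log (‖u x‖ ^ 2)| + 7 * ‖u x‖ ^ 2) :=
    hu.2.abs.add ((Lp.memLp u).norm.integrable_sq.const_mul 7)
  exact (lintegral_mono fun x => ENNReal.ofReal_le_ofReal (young_le_abs_log _)).trans_lt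
    (Integrable.lintegral_lt_top h1)

theorem lintegral_young_add_le {d : ℕ} (u v : L2 d) :
    ∫⁻ x, ENNReal.ofReal (young ‖(u + v : L2 d) x‖) ≤ 10 *
      ((∫⁻ x, ENNReal.ofReal (young ‖u x‖)) + ∫⁻ x, ENNReal.ofReal (young ‖v x‖)) := by
  have hum : Measurable u := (Lp.stronglyMeasurable u).measurable
  have hym := measurable_young
  rw [← lintegral_add_left (by fun_prop), ← lintegral_const_mul' _ _ (by simp)]
  refine lintegral_mono_ae ?_
  filter_upwards [Lp.coeFn_add u v] with x hx
  rw [hx, ← ENNReal.ofReal_add (young_nonneg (norm_nonneg _)) (young_nonneg (norm_nonneg _)),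
    ← ENNReal.ofReal_ofNat 10, ← ENNReal.ofReal_mul (by norm_num)]
  exact ENNReal.ofReal_le_ofReal ((young_mono (norm_nonneg _) (norm_add_le _ _)).trans
    (young_add_le (norm_nonneg _) (norm_nonneg _)))

theorem lintegral_young_sub_lt_top {d : ℕ} {u v : L2 d}
    (hu : ∫⁻ x, ENNReal.ofReal (young ‖u x‖) < ⊤) (hv : ∫⁻ x, ENNReal.ofReal (young ‖v x‖) < ⊤) :
    ∫⁻ x, ENNReal.ofReal (young ‖(u - v : L2 d) x‖) < ⊤ := by
  have hneg : ∫⁻ x, ENNReal.ofReal (young ‖(-v : L2 d) x‖)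
      = ∫⁻ x, ENNReal.ofReal (young ‖v x‖) := by
    refine lintegral_congr_ae ?_
    filter_upwards [Lp.coeFn_neg v] with x hx
    rw [hx, Pi.neg_apply, norm_neg]
  rw [sub_eq_add_neg]
  refine (lintegral_young_add_le u (-v)).trans_lt (ENNReal.mul_lt_top (by simp) ?_)
  rw [hneg]
  exact ENNReal.add_lt_top.2 ⟨hu, hv⟩

/-- `q` is an exponent for which the Sobolev embedding into `L^{2q}` holds. -/
def IsSobolevExponent (d : ℕ) (q : ℝ) : Prop := ∀ M : ℝ,
  ∃ C : ℝ≥0∞, C ≠ ⊤ ∧ ∀ (u : L2 d) (g : Fin d → L2 d), IsWeakGradient u g →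
    ∫⁻ x, ENNReal.ofReal (young ‖u x‖) < ⊤ → ‖u‖ ≤ M → (∀ i, ‖g i‖ ≤ M) →
    ∫⁻ x, ENNReal.ofReal (‖u x‖ ^ (2 * q)) ≤ C

/-- One constant serves a whole neighbourhood of `u` in the energy space, hence a solution at all
times near a given one. Doubling controls the Young part of `u + h`, and the Sobolev embedding its
`L^{2q}` part. -/
theorem exists_logModular_le {d : ℕ} {q : ℝ} (hq : IsSobolevExponent d q) {u : L2 d}
    (hu : u ∈ energySpace d) : ∃ K : ℝ, 0 ≤ K ∧ ∀ (h : L2 d) (g : Fin d → L2 d),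
      IsWeakGradient h g → (∀ i, ‖g i‖ ≤ 1) → ‖h‖ ≤ 1 → IsSmall h 1 →
      logModular q (u + h : L2 d) ≤ ENNReal.ofReal K := by
  obtain ⟨G, hG⟩ := hu.1
  obtain ⟨C, hC, hCb⟩ := hq (‖u‖ + ∑ i, ‖G i‖ + 1)
  have hfin := lintegral_young_lt_top_of_mem_energySpace hu
  set K : ℝ≥0∞ := 10 * ((∫⁻ x, ENNReal.ofReal (young ‖u x‖)) + 1) + C
  have hK : K ≠ ⊤ := by
    refine ENNReal.add_ne_top.2 ⟨ENNReal.mul_ne_top (by simp) ?_, hC⟩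
    exact ENNReal.add_ne_top.2 ⟨hfin.ne, ENNReal.one_ne_top⟩
  refine ⟨K.toReal, ENNReal.toReal_nonneg, fun h g hg hg1 hh1 hh => ?_⟩
  rw [ENNReal.ofReal_toReal hK, logModular]
  have hym := measurable_young
  have hm : Measurable (u + h : L2 d) := (Lp.stronglyMeasurable _).measurable
  have hsum : ∀ i, ‖G i‖ ≤ ∑ i, ‖G i‖ := fun i =>
    Finset.single_le_sum (f := fun i => ‖G i‖) (fun i _ => norm_nonneg _) (Finset.mem_univ i)
  have hsum0 : 0 ≤ ∑ i, ‖G i‖ := Finset.sum_nonneg fun i _ => norm_nonneg _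
  have hy : ∫⁻ x, ENNReal.ofReal (young ‖(u + h : L2 d) x‖)
      ≤ 10 * ((∫⁻ x, ENNReal.ofReal (young ‖u x‖)) + 1) := by
    refine (lintegral_young_add_le u h).trans ?_
    gcongr
    simpa using hh.young_le
  have hs := hCb (u + h) (G + g) (hG.add hg)
    (hy.trans_lt (ENNReal.mul_lt_top (by simp) (ENNReal.add_lt_top.2 ⟨hfin, by simp⟩)))
    ((norm_add_le _ _).trans (by linarith))
    (fun i => (norm_add_le _ _).trans (by linarith [hsum i, hg1 i, norm_nonneg u]))
  calc _ = (∫⁻ x, ENNReal.ofReal (young ‖(u + h : L2 d) x‖))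
        + ∫⁻ x, ENNReal.ofReal (‖(u + h : L2 d) x‖ ^ (2 * q)) := by
        rw [← lintegral_add_left (by fun_prop)]
        refine lintegral_congr fun x => ?_
        rw [ENNReal.ofReal_add (young_nonneg (norm_nonneg _)) (by positivity)]
    _ ≤ _ := add_le_add hy hs

/-! ### The energy estimate for the difference of two solutions -/

/-- The imaginary part of the pairing of a difference of nonlinearities with an approximation of
twice the difference of the functions. -/
theorem abs_im_nonlinear_le {d : ℕ} {q C : ℝ} (hq : IsPairingConst q C) (hC : 0 ≤ C)
    {v₁ v₂ : L2 d} {φ : EuclideanSpace ℝ (Fin d) → ℂ} (hφ : IsTestFunction φ)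
    {ι : Type*} [Fintype ι] {p : ι → L2 d} {ε K : ℝ} (hε : 0 < ε) (hK : 0 ≤ K)
    (hp : ∀ j, IsSmall (p j) ε)
    (hφp : ∀ᵐ x, ‖φ x - 2 * (v₁ x - v₂ x)‖ ≤ ∑ j, ‖p j x‖)
    (h₁ : logModular q v₁ ≤ ENNReal.ofReal K) (h₂ : logModular q v₂ ≤ ENNReal.ofReal K) :
    |((∫ x, logNonlinearity (v₁ x) * (starRingEnd ℂ) (φ x))
        - ∫ x, logNonlinearity (v₂ x) * (starRingEnd ℂ) (φ x)).im|
      ≤ 4 * ‖v₁ - v₂‖ ^ 2 + ε * (Fintype.card ι * (2 * (C * K + 3))) := by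
  have hi₁ := hφ.integrable_pairing hq hC v₁ (h₁.trans_lt ENNReal.ofReal_lt_top)
  have hi₂ := hφ.integrable_pairing hq hC v₂ (h₂.trans_lt ENNReal.ofReal_lt_top)
  have hm₁ : Measurable v₁ := (Lp.stronglyMeasurable v₁).measurable
  have hm₂ : Measurable v₂ := (Lp.stronglyMeasurable v₂).measurable
  have hmw : Measurable (v₁ - v₂ : L2 d) := (Lp.stronglyMeasurable _).measurable
  have hmp : ∀ j, Measurable (p j) := fun j => (Lp.stronglyMeasurable (p j)).measurable
  have hlm := measurable_logNonlinearity
  have hCK : 0 ≤ C * K + 3 := by positivity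
  rw [← integral_sub hi₁ hi₂]
  set F : EuclideanSpace ℝ (Fin d) → ℂ := fun x => logNonlinearity (v₁ x) * (starRingEnd ℂ) (φ x)
    - logNonlinearity (v₂ x) * (starRingEnd ℂ) (φ x) with hF
  have him : (∫ x, F x).im = ∫ x, (F x).im :=
    (integral_im (𝕜 := ℂ) (hi₁.sub hi₂)).symm
  rw [him, ← ENNReal.ofReal_le_ofReal_iff (by positivity), ← Real.enorm_eq_ofReal_abs]
  refine (enorm_integral_le_lintegral_enorm _).trans ?_
  have hpt : ∀ᵐ x, ‖(F x).im‖ₑ ≤ 4 * ‖(v₁ - v₂ : L2 d) x‖ₑ ^ 2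
      + ∑ j, (‖logNonlinearity (v₁ x)‖ₑ * ‖p j x‖ₑ + ‖logNonlinearity (v₂ x)‖ₑ * ‖p j x‖ₑ) := by
    filter_upwards [hφp, Lp.coeFn_sub v₁ v₂] with x hx hx'
    rw [hx', Pi.sub_apply]
    -- The part of `φ` equal to `2 (v₁ - v₂)` is handled by Cazenave–Haraux, whence the constant `2
    -- · 2 = 4`; the remainder is an error. Dominating the remainder by a sum of small pieces avoids
    -- any triangle inequality for the Luxemburg norm.
    have e1 : (F x).im = 2 * ((logNonlinearity (v₁ x) - logNonlinearity (v₂ x))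
          * (starRingEnd ℂ) (v₁ x - v₂ x)).im
        + ((logNonlinearity (v₁ x) - logNonlinearity (v₂ x))
          * (starRingEnd ℂ) (φ x - 2 * (v₁ x - v₂ x))).im := by
      simp only [hF, Complex.mul_im, Complex.sub_im, Complex.sub_re, Complex.conj_re,
        Complex.conj_im, Complex.mul_re, Complex.re_ofNat, Complex.im_ofNat]
      ring
    have e2 := abs_im_logNonlinearity_sub_le (v₁ x) (v₂ x)
    have e3 : |((logNonlinearity (v₁ x) - logNonlinearity (v₂ x))
        * (starRingEnd ℂ) (φ x - 2 * (v₁ x - v₂ x))).im|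
        ≤ (‖logNonlinearity (v₁ x)‖ + ‖logNonlinearity (v₂ x)‖) * ∑ j, ‖p j x‖ := by
      refine (Complex.abs_im_le_norm _).trans ?_
      rw [norm_mul, RCLike.norm_conj]
      gcongr
      exact norm_sub_le _ _
    have e4 : |(F x).im| ≤ 4 * ‖v₁ x - v₂ x‖ ^ 2
        + ∑ j, (‖logNonlinearity (v₁ x)‖ * ‖p j x‖ + ‖logNonlinearity (v₂ x)‖ * ‖p j x‖) := by
      rw [e1, Finset.sum_add_distrib, ← Finset.mul_sum, ← Finset.mul_sum, ← add_mul]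
      refine (abs_add_le _ _).trans (add_le_add ?_ e3)
      rw [abs_mul, abs_two]
      linarith
    rw [Real.enorm_eq_ofReal_abs]
    refine (ENNReal.ofReal_le_ofReal e4).trans_eq ?_
    rw [ENNReal.ofReal_add (by positivity) (Finset.sum_nonneg fun j _ => by positivity),
      ENNReal.ofReal_sum_of_nonneg fun j _ => by positivity, ENNReal.ofReal_mul (by norm_num),
      ENNReal.ofReal_pow (norm_nonneg _), ofReal_norm, ENNReal.ofReal_ofNat]
    congr 1
    refine Finset.sum_congr rfl fun j _ => ?_
    rw [ENNReal.ofReal_add (by positivity) (by positivity), ENNReal.ofReal_mul (norm_nonneg _),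
      ENNReal.ofReal_mul (norm_nonneg _)]
    simp only [ofReal_norm]
  refine (lintegral_mono_ae hpt).trans ?_
  rw [lintegral_add_left (by fun_prop), lintegral_const_mul _ (by fun_prop),
    lintegral_finsetSum _ (by fun_prop), ← eLpNorm_two_sq]
  have hw : eLpNorm (v₁ - v₂ : L2 d) 2 volume = ENNReal.ofReal ‖v₁ - v₂‖ := by
    rw [Lp.norm_def, ENNReal.ofReal_toReal (Lp.memLp _).2.ne]
  rw [hw, ENNReal.ofReal_add (by positivity) (by positivity), ENNReal.ofReal_mul (by norm_num),
    ENNReal.ofReal_pow (norm_nonneg _), ENNReal.ofReal_ofNat]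
  gcongr
  calc _ ≤ ∑ _j : ι, ENNReal.ofReal (ε * (2 * (C * K + 3))) := by
        refine Finset.sum_le_sum fun j _ => ?_
        rw [lintegral_add_left (by fun_prop)]
        calc _ ≤ ENNReal.ofReal (ε * (C * K + 3)) + ENNReal.ofReal (ε * (C * K + 3)) :=
              add_le_add
                ((hp j).lintegral_pairing_le hq hC hm₁.aemeasurable (hmp j).aemeasurable hε hK h₁)
                ((hp j).lintegral_pairing_le hq hC hm₂.aemeasurable (hmp j).aemeasurable hε hK h₂)
          _ = _ := by
            rw [← ENNReal.ofReal_add (by positivity) (by positivity)]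
            congr 1; ring
    _ = _ := by
      rw [Finset.sum_const, Finset.card_univ, nsmul_eq_mul, ← ENNReal.ofReal_natCast,
        ← ENNReal.ofReal_mul (by positivity)]
      congr 1; ring

/-- Since `⟨W i, W i⟩` is real, only the error `Φ i - 2 W i` contributes: this is the disappearance
of the Laplacian. -/
theorem abs_im_sum_inner_le {d : ℕ} {W Φ : Fin d → L2 d} {M δ : ℝ} (hM : ∀ i, ‖W i‖ ≤ M)
    (hΦ : ∀ i, ‖Φ i - (2 : ℂ) • W i‖ ≤ δ) (hδ : 0 ≤ δ) :
    |(∑ i, inner ℂ (Φ i) (W i)).im| ≤ d * (δ * M) := by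
  rw [Complex.im_sum]
  refine (Finset.abs_sum_le_sum_abs _ _).trans ?_
  calc _ ≤ ∑ _i : Fin d, δ * M := by
        refine Finset.sum_le_sum fun i _ => ?_
        have h1 : inner ℂ (Φ i) (W i) = inner ℂ (Φ i - (2 : ℂ) • W i) (W i)
            + 2 * inner ℂ (W i) (W i) := by
          rw [inner_sub_left, inner_smul_left, map_ofNat]
          ring
        have h2 : (inner ℂ (W i) (W i)).im = 0 := inner_self_im (𝕜 := ℂ) (W i)
        have h3 : (inner ℂ (Φ i) (W i)).im = (inner ℂ (Φ i - (2 : ℂ) • W i) (W i)).im := by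
          rw [h1, Complex.add_im, Complex.mul_im, h2, Complex.im_ofNat]
          ring
        rw [h3]
        refine (Complex.abs_im_le_norm _).trans ((norm_inner_le_norm _ _).trans ?_)
        exact mul_le_mul (hΦ i) (hM i) (norm_nonneg _) hδ
    _ = _ := by simp

theorem re_inner_add_sub {d : ℕ} (a b : L2 d) :
    (inner ℂ (a + b) (b - a)).re = ‖b‖ ^ 2 - ‖a‖ ^ 2 := by
  have h1 : (inner ℂ b b : ℂ).re = ‖b‖ ^ 2 := inner_self_eq_norm_sq (𝕜 := ℂ) b
  have h2 : (inner ℂ a a : ℂ).re = ‖a‖ ^ 2 := inner_self_eq_norm_sq (𝕜 := ℂ) a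
  have h3 : (inner ℂ a b : ℂ).re = (inner ℂ b a : ℂ).re := inner_re_symm (𝕜 := ℂ) a b
  rw [inner_add_left, inner_sub_right, inner_sub_right]
  simp only [Complex.add_re, Complex.sub_re]
  linarith

theorem norm_toL2_sub_le {d : ℕ} {φ : EuclideanSpace ℝ (Fin d) → ℂ} (hφ : IsTestFunction φ)
    {u : L2 d} {ε : ℝ} (hε : 0 ≤ ε)
    (h : eLpNorm (fun x => φ x - u x) 2 volume ≤ ENNReal.ofReal ε) : ‖hφ.toL2 - u‖ ≤ ε := by
  rw [Lp.norm_def]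
  refine ENNReal.toReal_le_of_le_ofReal hε (le_of_eq_of_le (eLpNorm_congr_ae ?_) h)
  filter_upwards [Lp.coeFn_sub hφ.toL2 u, hφ.coeFn_toL2] with x h1 h2
  rw [h1, Pi.sub_apply, h2]

/-- The real part of the right-hand side of the tested equation for a difference of two
solutions. -/
theorem abs_re_tested_equation_le {d : ℕ} {q C : ℝ} (hq : IsPairingConst q C) (hC : 0 ≤ C)
    {u₁ u₂ : L2 d} {g₁ g₂ : Fin d → L2 d} {φ : EuclideanSpace ℝ (Fin d) → ℂ}
    (hφ : IsTestFunction φ) {ι : Type*} [Fintype ι] {p : ι → L2 d} {ε K M δ lam : ℝ} (hε : 0 < ε)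
    (hK : 0 ≤ K) (hδ : 0 ≤ δ) (hlam : 0 ≤ lam) (hp : ∀ j, IsSmall (p j) ε)
    (hφp : ∀ᵐ x, ‖φ x - 2 * (u₁ x - u₂ x)‖ ≤ ∑ j, ‖p j x‖)
    (h₁ : logModular q u₁ ≤ ENNReal.ofReal K) (h₂ : logModular q u₂ ≤ ENNReal.ofReal K)
    (hM : ∀ i, ‖g₁ i - g₂ i‖ ≤ M)
    (hΦ : ∀ i, ‖(hφ.partialDeriv i).toL2 - (2 : ℂ) • (g₁ i - g₂ i)‖ ≤ δ) :
    |(Complex.I * ((1 / 2) * (-∑ i, inner ℂ (hφ.partialDeriv i).toL2 (g₁ i))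
          + lam * ∫ x, logNonlinearity (u₁ x) * (starRingEnd ℂ) (φ x))
        - Complex.I * ((1 / 2) * (-∑ i, inner ℂ (hφ.partialDeriv i).toL2 (g₂ i))
          + lam * ∫ x, logNonlinearity (u₂ x) * (starRingEnd ℂ) (φ x))).re|
      ≤ 1 / 2 * (d * (δ * M))
        + lam * (4 * ‖u₁ - u₂‖ ^ 2 + ε * (Fintype.card ι * (2 * (C * K + 3)))) := by
  have hN := abs_im_nonlinear_le hq hC hφ hε hK hp hφp h₁ h₂
  have hL := abs_im_sum_inner_le hM hΦ hδ
  simp_rw [inner_sub_right] at hL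
  rw [Finset.sum_sub_distrib] at hL
  generalize ∑ i, inner ℂ ((hφ.partialDeriv i).toL2) (g₁ i) = S₁ at *
  generalize ∑ i, inner ℂ ((hφ.partialDeriv i).toL2) (g₂ i) = S₂ at *
  generalize ∫ x, logNonlinearity (u₁ x) * (starRingEnd ℂ) (φ x) = I₁ at *
  generalize ∫ x, logNonlinearity (u₂ x) * (starRingEnd ℂ) (φ x) = I₂ at *
  have e1 : Complex.I * (1 / 2 * -S₁ + lam * I₁) - Complex.I * (1 / 2 * -S₂ + lam * I₂)
      = Complex.I * (((-1 / 2 : ℝ) : ℂ) * (S₁ - S₂) + (lam : ℂ) * (I₁ - I₂)) := by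
    push_cast; ring
  have hre : (Complex.I * (1 / 2 * -S₁ + lam * I₁) - Complex.I * (1 / 2 * -S₂ + lam * I₂)).re
      = 1 / 2 * (S₁ - S₂).im - lam * (I₁ - I₂).im := by
    rw [e1, Complex.I_mul_re, Complex.add_im, Complex.im_ofReal_mul, Complex.im_ofReal_mul]
    ring
  rw [hre]
  refine (abs_sub _ _).trans ?_
  rw [abs_mul, abs_mul, abs_of_nonneg hlam, abs_of_nonneg (by norm_num : (0 : ℝ) ≤ 1 / 2)]
  gcongr

/-- If `φ` approximates `(a₁ - a₂) + (b₁ - b₂)`, then it approximates `2 (c₁ - c₂)` up to the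
distances of the `aᵢ` from the `bᵢ` and the `cᵢ`. -/
theorem norm_sub_two_mul_sub_le {d : ℕ} {φ : EuclideanSpace ℝ (Fin d) → ℂ}
    (hφ : IsTestFunction φ) (a₁ a₂ b₁ b₂ c₁ c₂ : L2 d) :
    ∀ᵐ x, ‖φ x - 2 * (c₁ x - c₂ x)‖ ≤ ∑ j, ‖(![hφ.toL2 - ((a₁ - a₂) + (b₁ - b₂)), b₁ - a₁,
      b₂ - a₂, c₁ - a₁, c₁ - a₁, c₂ - a₂, c₂ - a₂] : Fin 7 → L2 d) j x‖ := by
  filter_upwards [Lp.coeFn_sub hφ.toL2 ((a₁ - a₂) + (b₁ - b₂)), hφ.coeFn_toL2,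
    Lp.coeFn_sub b₁ a₁, Lp.coeFn_sub b₂ a₂, Lp.coeFn_sub c₁ a₁, Lp.coeFn_sub c₂ a₂,
    Lp.coeFn_add (a₁ - a₂) (b₁ - b₂), Lp.coeFn_sub a₁ a₂,
    Lp.coeFn_sub b₁ b₂] with x e1 e2 e3 e4 e5 e6 e7 e8 e9
  simp only [Fin.sum_univ_succ, Matrix.cons_val_zero, Matrix.cons_val_succ,
    Finset.univ_eq_empty, Finset.sum_empty]
  rw [e1, e3, e4, e5, e6]
  simp only [Pi.sub_apply]
  rw [e2, e7, Pi.add_apply, e8, e9]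
  simp only [Pi.sub_apply]
  -- The coefficient `2` of `c₁ - c₂` is why `c₁ - a₁` and `c₂ - a₂` each occur twice.
  have hdec : φ x - 2 * (c₁ x - c₂ x) = (φ x - ((a₁ x - a₂ x) + (b₁ x - b₂ x)))
      + ((b₁ x - a₁ x) + (-(b₂ x - a₂ x) + (-(c₁ x - a₁ x) + (-(c₁ x - a₁ x)
      + ((c₂ x - a₂ x) + (c₂ x - a₂ x)))))) := by ring
  rw [hdec, add_zero]
  refine (norm_add_le _ _).trans (add_le_add le_rfl ?_)
  refine (norm_add_le _ _).trans (add_le_add le_rfl ?_)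
  refine (norm_add_le _ _).trans (add_le_add (norm_neg _).le ?_)
  refine (norm_add_le _ _).trans (add_le_add (norm_neg _).le ?_)
  refine (norm_add_le _ _).trans (add_le_add (norm_neg _).le ?_)
  exact norm_add_le _ _

/-- A mean value inequality for the squared norm of a curve in `L²`, tested against an
approximation of the sum of the endpoints. -/
theorem abs_norm_sq_sub_norm_sq_le {d : ℕ} {w : ℝ → L2 d} {Φ : L2 d} {s t δ B ε : ℝ}
    (hδ : 0 < δ) (ht : t ∈ Metric.ball s δ)
    (hder : ∀ τ ∈ Metric.ball s δ, ∃ D : ℂ, HasDerivAt (fun r => inner ℂ Φ (w r)) D τ ∧ |D.re| ≤ B)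
    (hΦ : ‖Φ - (w s + w t)‖ ≤ ε) :
    |‖w t‖ ^ 2 - ‖w s‖ ^ 2| ≤ B * |t - s| + ε * ‖w t - w s‖ := by
  have hre : ∀ {τ : ℝ} {D : ℂ}, HasDerivAt (fun r => inner ℂ Φ (w r)) D τ →
      HasDerivAt (fun r => (inner ℂ Φ (w r)).re) D.re τ := fun {τ D} hD =>
    Complex.reCLM.hasFDerivAt.comp_hasDerivAt τ hD
  have hmvt := (convex_ball s δ).norm_image_sub_le_of_norm_hasDerivWithin_le
    (f := fun r => (inner ℂ Φ (w r)).re) (f' := deriv fun r => (inner ℂ Φ (w r)).re) (C := B)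
    (fun τ hτ => by
      obtain ⟨D, hD, -⟩ := hder τ hτ
      exact (hre hD).differentiableAt.hasDerivAt.hasDerivWithinAt)
    (fun τ hτ => by
      obtain ⟨D, hD, hDB⟩ := hder τ hτ
      rw [(hre hD).deriv]
      exact hDB)
    (Metric.mem_ball_self hδ) ht
  simp only [Real.norm_eq_abs] at hmvt
  rw [← Complex.sub_re, ← inner_sub_right] at hmvt
  have e1 := re_inner_add_sub (w s) (w t)
  have e2 : inner ℂ (w s + w t) (w t - w s)
      = inner ℂ Φ (w t - w s) - inner ℂ (Φ - (w s + w t)) (w t - w s) := by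
    rw [inner_sub_left Φ]; ring
  rw [e2, Complex.sub_re] at e1
  rw [← e1]
  refine (abs_sub _ _).trans (add_le_add hmvt ?_)
  refine (Complex.abs_re_le_norm _).trans ((norm_inner_le_norm _ _).trans ?_)
  gcongr

/-- The local differential inequality for the squared distance of two solutions. -/
theorem IsSolution.eventually_abs_norm_sq_sub_le {d : ℕ} (hd : 1 ≤ d) {lam : ℝ} (hlam : 0 ≤ lam)
    {v₁ v₂ : ℝ → L2 d} (h₁ : IsSolution lam v₁) (h₂ : IsSolution lam v₂) (s : ℝ) {η : ℝ}
    (hη : 0 < η) :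
    ∀ᶠ t in 𝓝 s, |‖v₁ t - v₂ t‖ ^ 2 - ‖v₁ s - v₂ s‖ ^ 2|
      ≤ (4 * lam * ‖v₁ s - v₂ s‖ ^ 2 + η) * |t - s| := by
  obtain ⟨q, hq1, hqS⟩ := exists_sobolev_exponent hd
  obtain ⟨C, hC0, hC⟩ := exists_log_pairing_le hq1
  obtain ⟨K₁, hK₁, hK₁b⟩ := exists_logModular_le hqS (h₁.mem_energySpace s)
  obtain ⟨K₂, hK₂, hK₂b⟩ := exists_logModular_le hqS (h₂.mem_energySpace s)
  obtain ⟨G₁, hG₁⟩ := (h₁.mem_energySpace s).1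
  obtain ⟨G₂, hG₂⟩ := (h₂.mem_energySpace s).1
  obtain ⟨K, hK, hK₁K, hK₂K⟩ : ∃ K, 0 ≤ K ∧ K₁ ≤ K ∧ K₂ ≤ K :=
    ⟨max K₁ K₂, hK₁.trans (le_max_left _ _), le_max_left _ _, le_max_right _ _⟩
  obtain ⟨M, hM0, hM⟩ : ∃ M : ℝ, 0 ≤ M ∧ ∀ i, ‖G₁ i - G₂ i‖ + 2 ≤ M :=
    ⟨∑ i, ‖G₁ i - G₂ i‖ + 2, add_nonneg (Finset.sum_nonneg fun i _ => norm_nonneg _) zero_le_two,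
      fun i => add_le_add_left (Finset.single_le_sum (f := fun i => ‖G₁ i - G₂ i‖)
        (fun i _ => norm_nonneg _) (Finset.mem_univ i)) 2⟩
  obtain ⟨n, hn⟩ : ∃ n, n = ‖v₁ s - v₂ s‖ := ⟨_, rfl⟩
  have hn0 : 0 ≤ n := hn ▸ norm_nonneg _
  rw [← hn]
  -- `L` collects all errors of order `ε`: `(n + 2ε)² ≤ n² + ε (4n + 4)` for `ε ≤ 1`, the gradient
  -- mismatch, made of seven terms of size at most `ε`, and the seven pieces paired with the
  -- nonlinearity.
  obtain ⟨L, hL⟩ : ∃ L, L = 4 * lam * (4 * n + 4) + 1 / 2 * (d * (7 * M))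
    + lam * (7 * (2 * (C * K + 3))) := ⟨_, rfl⟩
  have hL0 : 0 ≤ L := by rw [hL]; positivity
  obtain ⟨ε, hε, hε1, hεL⟩ : ∃ ε : ℝ, 0 < ε ∧ ε ≤ 1 ∧ ε * L ≤ η := by
    refine ⟨min 1 (η / (L + 1)), by positivity, min_le_left _ _, ?_⟩
    calc _ ≤ η / (L + 1) * L := by gcongr; exact min_le_right _ _
      _ ≤ η := by rw [div_mul_eq_mul_div, div_le_iff₀ (by positivity)]; nlinarith
  -- A whole ball is needed, since the mean value inequality requires the derivative bound at every
  -- `τ` between `s` and `t`.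
  obtain ⟨δ, hδ, hclose⟩ := Metric.eventually_nhds_iff_ball.1
    ((h₁.eventually_close s hε).and (h₂.eventually_close s hε))
  filter_upwards [Metric.ball_mem_nhds s hδ] with t ht
  obtain ⟨⟨a₁, ha₁, ha₁n, ha₁s, ha₁v⟩, ⟨a₂, ha₂, ha₂n, ha₂s, ha₂v⟩⟩ := hclose t ht
  -- the function to be approximated by test functions
  set ψ : L2 d := (v₁ s - v₂ s) + (v₁ t - v₂ t) with hψ
  set Ψ : Fin d → L2 d := (G₁ - G₂) + ((G₁ + a₁) - (G₂ + a₂)) with hΨ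
  have hψg : IsWeakGradient ψ Ψ := by
    refine (hG₁.sub hG₂).add (IsWeakGradient.sub ?_ ?_)
    · simpa using hG₁.add ha₁
    · simpa using hG₂.add ha₂
  have hψy : ∫⁻ x, ENNReal.ofReal (young ‖ψ x‖) < ⊤ := by
    have hy₁ := fun r => lintegral_young_lt_top_of_mem_energySpace (h₁.mem_energySpace r)
    have hy₂ := fun r => lintegral_young_lt_top_of_mem_energySpace (h₂.mem_energySpace r)
    exact (lintegral_young_add_le _ _).trans_lt (ENNReal.mul_lt_top (by simp)
      (ENNReal.add_lt_top.2 ⟨lintegral_young_sub_lt_top (hy₁ s) (hy₂ s),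
        lintegral_young_sub_lt_top (hy₁ t) (hy₂ t)⟩))
  obtain ⟨B, hB⟩ : ∃ B, B = 4 * lam * n ^ 2 + ε * L := ⟨_, rfl⟩
  have hBη : B ≤ 4 * lam * n ^ 2 + η := by linarith
  refine le_trans ?_ (mul_le_mul_of_nonneg_right hBη (abs_nonneg _))
  -- the estimate up to the error of the approximation of `ψ`
  have key : ∀ ε' : ℝ, 0 < ε' → ε' ≤ ε → |‖v₁ t - v₂ t‖ ^ 2 - n ^ 2|
      ≤ B * |t - s| + ε' * ‖(v₁ t - v₂ t) - (v₁ s - v₂ s)‖ := by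
    intro ε' hε' hε'ε
    obtain ⟨φ, hφ, hφψ, hφΨ, hφy⟩ := exists_testFunction_near hψg hψy hε'
    have hΦψ : ‖hφ.toL2 - ψ‖ ≤ ε' := norm_toL2_sub_le hφ hε'.le hφψ
    have hΦΨ : ∀ i, ‖(hφ.partialDeriv i).toL2 - Ψ i‖ ≤ ε := fun i =>
      (norm_toL2_sub_le (hφ.partialDeriv i) hε'.le (hφΨ i)).trans hε'ε
    have hsmall : IsSmall (hφ.toL2 - ψ : L2 d) ε := by
      have : IsSmall (fun x => φ x - ψ x) ε' := ⟨hφψ, hφy⟩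
      refine (this.mono hε' hε'ε).congr ?_
      filter_upwards [Lp.coeFn_sub hφ.toL2 ψ, hφ.coeFn_toL2] with x e1 e2
      rw [e1, Pi.sub_apply, e2]
    -- the derivative of the tested difference
    have hder : ∀ τ ∈ Metric.ball s δ, ∃ D : ℂ,
        HasDerivAt (fun r => inner ℂ hφ.toL2 (v₁ r - v₂ r)) D τ ∧
          |D.re| ≤ B := by
      intro τ hτ
      obtain ⟨⟨b₁, hb₁, hb₁n, hb₁s, hb₁v⟩, ⟨b₂, hb₂, hb₂n, hb₂s, hb₂v⟩⟩ := hclose τ hτ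
      have hg₁ : IsWeakGradient (v₁ τ) (G₁ + b₁) := by simpa using hG₁.add hb₁
      have hg₂ : IsWeakGradient (v₂ τ) (G₂ + b₂) := by simpa using hG₂.add hb₂
      have hD := (h₁.hasDerivAt_inner hφ hg₁).sub (h₂.hasDerivAt_inner hφ hg₂)
      refine ⟨_, hD.congr_of_eventuallyEq (Eventually.of_forall fun r => inner_sub_right _ _ _), ?_⟩
      have hm₁ : logModular q (v₁ τ) ≤ ENNReal.ofReal K := by
        have := hK₁b _ _ hb₁ (fun i => (hb₁n i).trans hε1) (hb₁v.trans hε1) (hb₁s.mono hε hε1)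
        rw [add_sub_cancel] at this
        exact this.trans (ENNReal.ofReal_le_ofReal hK₁K)
      have hm₂ : logModular q (v₂ τ) ≤ ENNReal.ofReal K := by
        have := hK₂b _ _ hb₂ (fun i => (hb₂n i).trans hε1) (hb₂v.trans hε1) (hb₂s.mono hε hε1)
        rw [add_sub_cancel] at this
        exact this.trans (ENNReal.ofReal_le_ofReal hK₂K)
      have hw : ‖v₁ τ - v₂ τ‖ ≤ n + 2 * ε := by
        have e1 : v₁ τ - v₂ τ = (v₁ s - v₂ s) + ((v₁ τ - v₁ s) - (v₂ τ - v₂ s)) := by abel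
        rw [e1, hn]
        linarith [norm_add_le (v₁ s - v₂ s) ((v₁ τ - v₁ s) - (v₂ τ - v₂ s)),
          norm_sub_le (v₁ τ - v₁ s) (v₂ τ - v₂ s)]
      have hw2 : ‖v₁ τ - v₂ τ‖ ^ 2 ≤ n ^ 2 + ε * (4 * n + 4) := by
        have := pow_le_pow_left₀ (norm_nonneg _) hw 2
        nlinarith
      refine (abs_re_tested_equation_le hC hC0.le hφ hε hK (by positivity : 0 ≤ 7 * ε) hlam
        (p := ![hφ.toL2 - ψ, v₁ t - v₁ s, v₂ t - v₂ s, v₁ τ - v₁ s, v₁ τ - v₁ s, v₂ τ - v₂ s,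
          v₂ τ - v₂ s]) (M := M) ?_ (norm_sub_two_mul_sub_le hφ _ _ _ _ _ _) hm₁ hm₂ ?_ ?_).trans ?_
      · intro j
        fin_cases j
        exacts [hsmall, ha₁s, ha₂s, hb₁s, hb₁s, hb₂s, hb₂s]
      · intro i
        have e1 : (G₁ + b₁) i - (G₂ + b₂) i = (G₁ i - G₂ i) + (b₁ i - b₂ i) := by
          simp only [Pi.add_apply]; abel
        rw [e1]
        linarith [hM i, norm_add_le (G₁ i - G₂ i) (b₁ i - b₂ i), norm_sub_le (b₁ i) (b₂ i),
          hb₁n i, hb₂n i]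
      · intro i
        have e1 : (hφ.partialDeriv i).toL2 - (2 : ℂ) • ((G₁ + b₁) i - (G₂ + b₂) i)
            = ((hφ.partialDeriv i).toL2 - Ψ i) + ((a₁ i - a₂ i)
              + ((-b₁ i) + ((-b₁ i) + (b₂ i + b₂ i)))) := by
          simp only [hΨ, Pi.sub_apply, Pi.add_apply, two_smul]; abel
        rw [e1]
        refine (norm_add_le _ _).trans ?_
        have e2 := norm_add_le (a₁ i - a₂ i) ((-b₁ i) + ((-b₁ i) + (b₂ i + b₂ i)))
        have e3 := norm_sub_le (a₁ i) (a₂ i)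
        have e4 := norm_add_le (-b₁ i) ((-b₁ i) + (b₂ i + b₂ i))
        have e5 := norm_add_le (-b₁ i) (b₂ i + b₂ i)
        have e6 := norm_add_le (b₂ i) (b₂ i)
        rw [norm_neg] at e4 e5
        linarith [hΦΨ i, ha₁n i, ha₂n i, hb₁n i, hb₂n i]
      · rw [Fintype.card_fin, hB, hL]
        have f2 := mul_le_mul_of_nonneg_left hw2 (by positivity : 0 ≤ lam * 4)
        push_cast
        linarith
    rw [hn]
    exact abs_norm_sq_sub_norm_sq_le (w := fun r => v₁ r - v₂ r) hδ ht hder hΦψ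
  -- With `t` fixed, the approximation error `ε'` tends to `0` while `B` stays put. This removes the
  -- term `ε' ν`, for which no bound proportional to `|t - s|` is at hand.
  refine le_of_forall_pos_le_add fun e he => ?_
  set ν := ‖(v₁ t - v₂ t) - (v₁ s - v₂ s)‖ with hν
  have hν0 : 0 ≤ ν := norm_nonneg _
  refine (key (min ε (e / (ν + 1))) (by positivity) (min_le_left _ _)).trans ?_
  gcongr
  calc _ ≤ e / (ν + 1) * ν := by gcongr; exact min_le_right _ _
    _ ≤ e := by rw [div_mul_eq_mul_div, div_le_iff₀ (by positivity)]; nlinarith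

/-! ### Grönwall and conclusion -/

/-- The local inequality bounds the right Dini derivative of `N` by `K N`, because `η` is arbitrary;
differentiability of `N` is not needed. -/
theorem le_mul_exp_of_eventually_sub_le {N : ℝ → ℝ} (hN : Continuous N) {K : ℝ}
    (h : ∀ s η : ℝ, 0 < η → ∀ᶠ t in 𝓝 s, |N t - N s| ≤ (K * N s + η) * |t - s|) {a b : ℝ}
    (hab : a ≤ b) : N b ≤ N a * Real.exp (K * (b - a)) := by
  have := le_gronwallBound_of_liminf_deriv_right_le (f := N) (f' := fun x => K * N x) (δ := N a)
    (K := K) (ε := 0) (a := a) (b := b) hN.continuousOn (fun x _ r hr => ?_) le_rfl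
    (fun x _ => by simp) b ⟨hab, le_rfl⟩
  · rwa [gronwallBound_ε0] at this
  · refine Eventually.frequently ?_
    filter_upwards [self_mem_nhdsWithin,
      nhdsWithin_le_nhds (h x ((r - K * N x) / 2) (by linarith))] with z hz hle
    have hz' : 0 < z - x := sub_pos.2 hz
    rw [abs_of_pos hz'] at hle
    rw [inv_mul_lt_iff₀ hz']
    nlinarith [le_abs_self (N z - N x)]

theorem IsSolution.continuous {d : ℕ} {lam : ℝ} {v : ℝ → L2 d} (hv : IsSolution lam v) :
    Continuous v := by
  refine continuous_iff_continuousAt.2 fun s => ?_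
  rw [ContinuousAt, tendsto_iff_norm_sub_tendsto_zero, Metric.tendsto_nhds]
  intro ε hε
  filter_upwards [hv.eventually_close s (half_pos hε)] with t ht
  obtain ⟨_, _, _, _, h⟩ := ht
  rw [dist_zero_right, norm_norm]
  linarith

end LogNLS

end

theorem lemma6p2 (d : ℕ) (hd : 1 ≤ d) (lam : ℝ) (hlam : 0 < lam)
    (v₁ v₂ : ℝ → LogNLS.L2 d)
    (h₁ : LogNLS.IsSolution lam v₁) (h₂ : LogNLS.IsSolution lam v₂) :
    v₁ = v₂ ∨
      ∃ C₂ : ℝ, 0 < C₂ ∧ ∀ t : ℝ, 0 ≤ t →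
        C₂ * Real.exp (-2 * lam * t) ≤ ‖v₁ t - v₂ t‖ := by
  have hcont : Continuous fun t => ‖v₁ t - v₂ t‖ ^ 2 :=
    ((h₁.continuous.sub h₂.continuous).norm).pow 2
  have hloc := fun s η (hη : 0 < η) => h₁.eventually_abs_norm_sq_sub_le hd hlam.le h₂ s hη
  have forward : ∀ {a b : ℝ}, a ≤ b →
      ‖v₁ b - v₂ b‖ ^ 2 ≤ ‖v₁ a - v₂ a‖ ^ 2 * Real.exp (4 * lam * (b - a)) :=
    fun hab => LogNLS.le_mul_exp_of_eventually_sub_le hcont hloc hab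
  have backward : ∀ {a b : ℝ}, a ≤ b →
      ‖v₁ a - v₂ a‖ ^ 2 ≤ ‖v₁ b - v₂ b‖ ^ 2 * Real.exp (4 * lam * (b - a)) := by
    intro a b hab
    -- The local inequality bounds an absolute value, so it is invariant under time reversal, and
    -- the forward estimate applies to `t ↦ -t`.
    have := LogNLS.le_mul_exp_of_eventually_sub_le (N := fun t => ‖v₁ (-t) - v₂ (-t)‖ ^ 2)
      (hcont.comp continuous_neg) (K := 4 * lam) (fun s η hη => by
        have := (continuous_neg.tendsto s).eventually (hloc (-s) η hη)
        filter_upwards [this] with t ht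
        rwa [neg_sub_neg, abs_sub_comm s t] at ht) (neg_le_neg hab)
    simpa only [neg_neg, neg_sub_neg] using this
  by_cases h0 : v₁ 0 - v₂ 0 = 0
  · left
    funext t
    have h : ‖v₁ t - v₂ t‖ ^ 2 ≤ 0 := by
      rcases le_total 0 t with ht | ht
      · simpa [h0] using forward ht
      · simpa [h0] using backward ht
    rw [← sub_eq_zero, ← norm_eq_zero]
    exact pow_eq_zero_iff two_ne_zero |>.1 (le_antisymm h (by positivity))
  · right
    -- The constant is the initial distance: the backward estimate from `t` to `0` carries `e^{4λt}`
    -- on squared norms, and the square root yields the rate `2λ`.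
    refine ⟨‖v₁ 0 - v₂ 0‖, norm_pos_iff.2 h0, fun t ht => ?_⟩
    refine le_of_sq_le_sq ?_ (norm_nonneg _)
    have h := backward ht
    have he : Real.exp (-2 * lam * t) ^ 2 * Real.exp (4 * lam * (t - 0)) = 1 := by
      rw [← Real.exp_nat_mul, ← Real.exp_add, ← Real.exp_zero]
      congr 1
      push_cast; ring
    calc _ = ‖v₁ 0 - v₂ 0‖ ^ 2 * Real.exp (-2 * lam * t) ^ 2 := mul_pow _ _ _
      _ ≤ (‖v₁ t - v₂ t‖ ^ 2 * Real.exp (4 * lam * (t - 0))) * Real.exp (-2 * lam * t) ^ 2 := by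
        gcongr
      _ = ‖v₁ t - v₂ t‖ ^ 2 := by rw [mul_assoc, mul_comm (Real.exp (4 * lam * (t - 0))), he, mul_one]
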